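/- **Lemma 4.2.** Let $k=\mathbf R$ or $\mathbf C$, let $Y$ be a compact Hausdorff space, and let $L$ be a real line bundle on $Y$ provided with a (continuous) metric. Write $\mathcal E(Y)$ for the category of $k$-vector bundles on $Y$ (of finite, locally constant rank). For $r\ge 0$ let $L+r$ be the sum of $L$ and the trivial real bundle of rank $r$, with the metric $|(t,x)|^2=|t|^2+x_1^2+\dots+x_r^2$. Let $C^+(L+r)$ be the bundle of real Clifford algebras of $L+r$ for this positive quadratic form (so $t\cdot t=|t|^2$ for $t \in L+r$), and let $C^-(L)$ be the Clifford bundle of $L$ for the negative form $t\mapsto-|t|^2$. For a Clifford bundle $A$ let $\mathcal E^{A}(Y)$ be the category of $k$-vector bundles on $Y$ with a continuous $k$-linear action of $A$. The morphism spaces of these categories carry the topology of their usual Banach space structure. For an additive continuous functor $\varphi:\mathcal C\to\mathcal C'$ between such categories let $K_n(\varphi)$, $n\ge 0$, be the abelian group generated by the triples $(E,F,\alpha)$, where $E,F$ are objects of $\mathcal C$ and $\alpha$ is a continuous family of isomorphisms $\varphi(E)\to\varphi(F)$ parametrized by the ball $D^n$, with a lift of $\alpha|_{S^{n-1}}$ to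 a continuous family of isomorphisms $E\to F$ in $\mathcal C$. The relations are: isomorphic triples are equal, a direct sum of triples is their sum, and $(E,E,\alpha)=0$ if $\alpha$ is homotopic to the identity through families of this kind. (For $n=0$ this is the Grothendieck group of $\varphi$.) For $i<0$ let $K_i(\varphi)=K_n(\varphi)$, where $n\in\{0,\dots,7\}$ and $n\equiv i \pmod 8$ (Bott periodicity). Then for every $i\in\mathbf Z$ the group $K_i$ of the forgetful functor $$\mathcal E^{C^-(L)}(Y)\to\mathcal E(Y)$$ is isomorphic to the group $K_i$ of the forgetful functor $$\mathcal E^{C^+(L+2)}(Y)\to\mathcal E^{C^+(L+1)}(Y)$$ given by restricting the action along the inclusion $L+1\subset L+2$, $(t,x_1)\mapsto(t,x_1,0)$. -/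

import Mathlib

open CategoryTheory Bundle Topology

universe u v w

noncomputable section

/-! ### Vector bundles (of locally constant rank) -/

/-- A `𝕜`-vector bundle on `Y`: a family of `𝕜`-vector spaces with a topology on the total space
which is locally isomorphic, by fibrewise linear homeomorphisms over the base, to a product
`U × 𝕜ⁿ`.  The rank `n` may depend on the point (Mathlib's `VectorBundle` has a fixed model fibre,
hence a constant rank).  The phantom argument of `TotalSpace` is irrelevant. -/
structure VecBundle (𝕜 : Type) [RCLike 𝕜] (Y : Type u) [TopologicalSpace Y] where
  /-- the fibres -/
  fiber : Y → Type v
  [addCommGroup : ∀ y, AddCommGroup (fiber y)]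
  [module : ∀ y, Module 𝕜 (fiber y)]
  /-- the topology of the total space -/
  [topology : TopologicalSpace (TotalSpace PUnit.{1} fiber)]
  locally_trivial : ∀ y : Y, ∃ (n : ℕ)
    (e : Trivialization (Fin n → 𝕜) (TotalSpace.proj : TotalSpace PUnit.{1} fiber → Y)),
    y ∈ e.baseSet ∧
      ∀ x ∈ e.baseSet, IsLinearMap 𝕜 (fun v : fiber x => (e (TotalSpace.mk x v)).2)

namespace VecBundle

attribute [instance] VecBundle.addCommGroup VecBundle.module VecBundle.topology

variable {𝕜 : Type} [RCLike 𝕜] {Y : Type u} [TopologicalSpace Y]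

/-- The total space of a vector bundle. -/
abbrev Total (E : VecBundle.{u, v} 𝕜 Y) : Type (max u v) := TotalSpace PUnit.{1} E.fiber

/-- The map of total spaces given by a family of linear maps. -/
def totalMap {E F : VecBundle.{u, v} 𝕜 Y} (f : ∀ y, E.fiber y →ₗ[𝕜] F.fiber y) :
    E.Total → F.Total :=
  fun z => ⟨z.proj, f z.proj z.snd⟩

/-- Morphisms of vector bundles: continuous, fibrewise linear maps over `Y`. -/
@[ext]
structure Hom (E F : VecBundle.{u, v} 𝕜 Y) where
  /-- the linear maps on the fibres -/
  app : ∀ y, E.fiber y →ₗ[𝕜] F.fiber y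
  continuous_totalMap : Continuous (totalMap app)

instance : Category (VecBundle.{u, v} 𝕜 Y) where
  Hom := Hom
  id E := ⟨fun _ => LinearMap.id, continuous_id⟩
  comp f g := ⟨fun y => (g.app y).comp (f.app y),
    g.continuous_totalMap.comp f.continuous_totalMap⟩

@[ext]
theorem hom_ext {E F : VecBundle.{u, v} 𝕜 Y} {f g : E ⟶ F} (h : ∀ y, f.app y = g.app y) :
    f = g :=
  Hom.ext (funext h)

@[simp]
theorem id_app (E : VecBundle.{u, v} 𝕜 Y) (y : Y) : Hom.app (𝟙 E) y = LinearMap.id := rfl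

@[simp]
theorem comp_app {E F G : VecBundle.{u, v} 𝕜 Y} (f : E ⟶ F) (g : F ⟶ G) (y : Y) :
    Hom.app (f ≫ g) y = (g.app y).comp (f.app y) := rfl

theorem continuous_proj (E : VecBundle.{u, v} 𝕜 Y) :
    Continuous (TotalSpace.proj : E.Total → Y) := by
  rw [continuous_iff_continuousAt]
  intro z
  obtain ⟨n, e, hy, -⟩ := E.locally_trivial z.proj
  exact e.continuousAt_proj (e.mem_source.2 hy)

/-- A family of linear maps is continuous if it is so in all linear local trivializations of the
target. -/
theorem continuous_totalMap_of_local {E F : VecBundle.{u, v} 𝕜 Y}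
    (f : ∀ y, E.fiber y →ₗ[𝕜] F.fiber y)
    (h : ∀ (n : ℕ) (e : Trivialization (Fin n → 𝕜) (TotalSpace.proj : F.Total → Y)),
      (∀ x ∈ e.baseSet, IsLinearMap 𝕜 (fun v : F.fiber x => (e (TotalSpace.mk x v)).2)) →
      ContinuousOn (fun x : E.Total => (e (totalMap f x)).2)
        ((TotalSpace.proj : E.Total → Y) ⁻¹' e.baseSet)) :
    Continuous (totalMap f) := by
  rw [continuous_iff_continuousAt]
  intro z
  obtain ⟨n, e, hy, hlin⟩ := F.locally_trivial z.proj
  have hU : IsOpen ((TotalSpace.proj : E.Total → Y) ⁻¹' e.baseSet) :=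
    e.open_baseSet.preimage E.continuous_proj
  have h2 : ContinuousOn (fun x : E.Total => e.toOpenPartialHomeomorph.symm
      (x.proj, (e (totalMap f x)).2)) ((TotalSpace.proj : E.Total → Y) ⁻¹' e.baseSet) := by
    refine e.toOpenPartialHomeomorph.continuousOn_symm.comp
      (E.continuous_proj.continuousOn.prodMk (h n e hlin)) ?_
    intro x hx
    exact e.mem_target.2 hx
  refine (h2.congr ?_).continuousAt (hU.mem_nhds hy)
  intro x hx
  have hs : totalMap f x ∈ e.source := e.mem_source.2 hx
  have e1 : e (totalMap f x) = (x.proj, (e (totalMap f x)).2) := Prod.ext (e.coe_fst hs) rfl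
  have h4 := e.toOpenPartialHomeomorph.left_inv hs
  change _ = e.toOpenPartialHomeomorph.symm _
  rw [← e1]
  exact h4.symm

theorem continuousOn_local {E F : VecBundle.{u, v} 𝕜 Y} (f : E ⟶ F) {n : ℕ}
    (e : Trivialization (Fin n → 𝕜) (TotalSpace.proj : F.Total → Y)) :
    ContinuousOn (fun x : E.Total => (e (totalMap f.app x)).2)
      ((TotalSpace.proj : E.Total → Y) ⁻¹' e.baseSet) :=
  continuous_snd.comp_continuousOn (ContinuousOn.comp (g := e) (t := e.source) e.continuousOn_toFun
    f.continuous_totalMap.continuousOn fun _ hx => e.mem_source.2 hx)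

instance (E F : VecBundle.{u, v} 𝕜 Y) : Zero (E ⟶ F) :=
  ⟨⟨fun _ => 0, continuous_totalMap_of_local _ fun n _ he =>
    (continuousOn_const (c := (0 : Fin n → 𝕜))).congr fun x hx => (he x.proj hx).map_zero⟩⟩

instance (E F : VecBundle.{u, v} 𝕜 Y) : Add (E ⟶ F) :=
  ⟨fun f g => ⟨fun y => f.app y + g.app y, continuous_totalMap_of_local _ fun _ e he =>
    ((continuousOn_local f e).add (continuousOn_local g e)).congr
      fun x hx => (he x.proj hx).map_add _ _⟩⟩

instance (E F : VecBundle.{u, v} 𝕜 Y) : Neg (E ⟶ F) :=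
  ⟨fun f => ⟨fun y => -f.app y, continuous_totalMap_of_local _ fun _ e he =>
    (continuousOn_local f e).neg.congr fun x hx => (he x.proj hx).map_neg _⟩⟩

@[simp]
theorem zero_app {E F : VecBundle.{u, v} 𝕜 Y} (y : Y) : Hom.app (0 : E ⟶ F) y = 0 := rfl

@[simp]
theorem add_app {E F : VecBundle.{u, v} 𝕜 Y} (f g : E ⟶ F) (y : Y) :
    Hom.app (f + g) y = f.app y + g.app y := rfl

@[simp]
theorem neg_app {E F : VecBundle.{u, v} 𝕜 Y} (f : E ⟶ F) (y : Y) :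
    Hom.app (-f) y = -f.app y := rfl

instance (E F : VecBundle.{u, v} 𝕜 Y) : AddCommGroup (E ⟶ F) where
  add_assoc f g h := by ext y : 1; simp [add_assoc]
  zero_add f := by ext y : 1; simp
  add_zero f := by ext y : 1; simp
  neg_add_cancel f := by ext y : 1; simp
  add_comm f g := by ext y : 1; simp [add_comm]
  nsmul := nsmulRec
  zsmul := zsmulRec

instance : Preadditive (VecBundle.{u, v} 𝕜 Y) where
  add_comp E F G f f' g := by ext y : 1; simp [LinearMap.comp_add]
  comp_add E F G f g g' := by ext y : 1; simp [LinearMap.add_comp]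

/-- The topology on the space of morphisms of vector bundles: the compact-open topology on the maps
of total spaces.  For compact Hausdorff `Y` it is the topology of the usual Banach space structure
on the space of morphisms (uniform convergence of the linear maps on the fibres). -/
instance (E F : VecBundle.{u, v} 𝕜 Y) : TopologicalSpace (E ⟶ F) :=
  TopologicalSpace.induced
    (fun f : E ⟶ F => (⟨totalMap f.app, f.continuous_totalMap⟩ : C(E.Total, F.Total)))
    ContinuousMap.compactOpen

end VecBundle

/-! ### Module bundles over a Clifford bundle -/

section Clifford

variable {Y : Type u} [TopologicalSpace Y]

/-- Let `T` be a real bundle on `Y` (with total space `TotalSpace F T`) and `Q` a family of quadratic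
forms on its fibres.  An object of this type is a `𝕜`-vector bundle `E` on `Y` with an action of the
bundle of Clifford algebras `C(T, Q)`: every fibre `E y` is a module over the Clifford algebra of
`(T y, Q y)` (`t * t = Q y t`), the action being by `𝕜`-linear maps and compatible with
`ℝ → 𝕜`, and the action is continuous.  As the Clifford bundle is generated, locally on `Y` and
continuously, by products of sections of `T`, continuity has to be required only for
`T ×_Y E → E`, `(t, v) ↦ t · v`. -/
structure CliffordModuleBundle (𝕜 : Type) [RCLike 𝕜] (F : Type*) {T : Y → Type w}
    [∀ y, AddCommGroup (T y)] [∀ y, Module ℝ (T y)] [TopologicalSpace (TotalSpace F T)]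
    (Q : ∀ y, QuadraticForm ℝ (T y)) where
  /-- the underlying vector bundle -/
  bundle : VecBundle.{u, v} 𝕜 Y
  /-- the action of the Clifford algebras on the fibres -/
  action : ∀ y, CliffordAlgebra (Q y) →+* Module.End 𝕜 (bundle.fiber y)
  action_algebraMap : ∀ (y : Y) (r : ℝ) (v : bundle.fiber y),
    action y (algebraMap ℝ _ r) v = (r : 𝕜) • v
  continuous_action : Continuous
    (fun p : TotalSpace (F × PUnit.{1}) (T ×ᵇ bundle.fiber) =>
      (⟨p.proj, action p.proj (CliffordAlgebra.ι (Q p.proj) p.snd.1) p.snd.2⟩ : bundle.Total))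

namespace CliffordModuleBundle

variable {𝕜 : Type} [RCLike 𝕜] {F : Type*} {T : Y → Type w}
  [∀ y, AddCommGroup (T y)] [∀ y, Module ℝ (T y)] [TopologicalSpace (TotalSpace F T)]
  {Q : ∀ y, QuadraticForm ℝ (T y)}

/-- Morphisms of bundles of Clifford modules: the morphisms of vector bundles which commute with the
action, as a subgroup. -/
def homSubgroup (M N : CliffordModuleBundle.{u, v, w} 𝕜 F Q) :
    AddSubgroup (M.bundle ⟶ N.bundle) where
  carrier := {f | ∀ y (a : CliffordAlgebra (Q y)) (x : M.bundle.fiber y),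
    f.app y (M.action y a x) = N.action y a (f.app y x)}
  zero_mem' := by intro y a x; simp
  add_mem' := by intro f g hf hg y a x; simp [hf y a x, hg y a x]
  neg_mem' := by intro f hf y a x; simp [hf y a x]

/-- The category of vector bundles on `Y` with an action of the Clifford bundle. -/
instance : Category (CliffordModuleBundle.{u, v, w} 𝕜 F Q) where
  Hom M N := homSubgroup M N
  id M := ⟨𝟙 M.bundle, fun _ _ _ => rfl⟩
  comp f g := ⟨f.1 ≫ g.1, fun y a x => by
    have h1 := f.2 y a x
    have h2 := g.2 y a (f.1.app y x)
    simp only [VecBundle.comp_app, LinearMap.comp_apply, h1, h2]⟩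

instance (M N : CliffordModuleBundle.{u, v, w} 𝕜 F Q) : AddCommGroup (M ⟶ N) :=
  inferInstanceAs (AddCommGroup (homSubgroup M N))

/-- The topology on the space of morphisms is the one of a subspace of the morphisms of vector
bundles. -/
instance (M N : CliffordModuleBundle.{u, v, w} 𝕜 F Q) : TopologicalSpace (M ⟶ N) :=
  inferInstanceAs (TopologicalSpace (homSubgroup M N))

instance : Preadditive (CliffordModuleBundle.{u, v, w} 𝕜 F Q) where
  add_comp _ _ _ f f' g := Subtype.ext (Preadditive.add_comp _ _ _ f.1 f'.1 g.1)
  comp_add _ _ _ f g g' := Subtype.ext (Preadditive.comp_add _ _ _ f.1 g.1 g'.1)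

/-- The forgetful functor from Clifford module bundles to vector bundles. -/
def forget (𝕜 : Type) [RCLike 𝕜] (F : Type*) (Q : ∀ y, QuadraticForm ℝ (T y))
    [TopologicalSpace (TotalSpace F T)] :
    CliffordModuleBundle.{u, v, w} 𝕜 F Q ⥤ VecBundle.{u, v} 𝕜 Y where
  obj M := M.bundle
  map f := f.1

instance : (forget.{u, v, w} 𝕜 F Q).Additive where
  map_add := rfl

variable {F' : Type*} {T' : Y → Type w}
  [∀ y, AddCommGroup (T' y)] [∀ y, Module ℝ (T' y)] [TopologicalSpace (TotalSpace F' T')]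
  {Q' : ∀ y, QuadraticForm ℝ (T' y)}

/-- The forgetful functor (restriction of the action) along a continuous bundle map `j : T → T'`
which is fibrewise linear and respects the quadratic forms, hence induces maps of Clifford algebras
`C(T) → C(T')`. -/
def restrict (𝕜 : Type) [RCLike 𝕜] (j : ∀ y, Q y →qᵢ Q' y)
    (hj : Continuous (fun t : TotalSpace F T => (⟨t.proj, j t.proj t.snd⟩ : TotalSpace F' T'))) :
    CliffordModuleBundle.{u, v, w} 𝕜 F' Q' ⥤ CliffordModuleBundle.{u, v, w} 𝕜 F Q where
  obj M :=
    { bundle := M.bundle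
      action := fun y => (M.action y).comp (CliffordAlgebra.map (j y)).toRingHom
      action_algebraMap := fun y r v => by simpa using M.action_algebraMap y r v
      continuous_action := by
        have hind := FiberBundle.Prod.isInducing_diag F T PUnit.{1} M.bundle.fiber
        have hind' := FiberBundle.Prod.isInducing_diag F' T' PUnit.{1} M.bundle.fiber
        have hc : Continuous (fun p : TotalSpace (F × PUnit.{1}) (T ×ᵇ M.bundle.fiber) =>
            (⟨p.proj, (j p.proj p.snd.1, p.snd.2)⟩ :
              TotalSpace (F' × PUnit.{1}) (T' ×ᵇ M.bundle.fiber))) := by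
          rw [hind'.continuous_iff]
          exact (hj.comp (continuous_fst.comp hind.continuous)).prodMk
            (continuous_snd.comp hind.continuous)
        have := M.continuous_action.comp hc
        simpa [Function.comp_def] using this }
  map f := ⟨f.1, fun y a x => f.2 y (CliffordAlgebra.map (j y) a) x⟩

instance (j : ∀ y, Q y →qᵢ Q' y)
    (hj : Continuous (fun t : TotalSpace F T => (⟨t.proj, j t.proj t.snd⟩ : TotalSpace F' T'))) :
    (restrict.{u, v, w} 𝕜 j hj).Additive where
  map_add := rfl

end CliffordModuleBundle

/-! ### The quadratic forms of a bundle with a metric -/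

section Metric

variable {L : Y → Type w} [∀ y, AddCommGroup (L y)] [∀ y, Module ℝ (L y)]
  [∀ y, TopologicalSpace (L y)] {F : Type*} [NormedAddCommGroup F] [NormedSpace ℝ F]
  [TopologicalSpace (TotalSpace F L)] [FiberBundle F L] [VectorBundle ℝ F L]

/-- The positive quadratic form `t ↦ |t|²` of a metric on a vector bundle. -/
def metricForm (g : ContinuousRiemannianMetric F L) (y : Y) : QuadraticForm ℝ (L y) :=
  LinearMap.BilinMap.toQuadraticMap
    (LinearMap.mk₂ ℝ (fun s t => g.inner y s t) (by simp) (by simp) (by simp) (by simp))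

/-- The opposite of the metric: the negative quadratic form `t ↦ -|t|²`, whose Clifford bundle is
`C⁻(L)`. -/
def negForm (g : ContinuousRiemannianMetric F L) (y : Y) : QuadraticForm ℝ (L y) :=
  -metricForm g y

/-- The bundle `L + r`: the vector bundle `L` with a trivial bundle of rank `r` added. -/
abbrev addTrivial (L : Y → Type w) (r : ℕ) : Y → Type w :=
  L ×ᵇ Bundle.Trivial Y (Fin r → ℝ)

/-- The positive quadratic form `(t, x) ↦ |t|² + x₁² + ⋯ + xᵣ²` on `L + r`, whose Clifford bundle is
`C⁺(L + r)`. -/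
def posForm (g : ContinuousRiemannianMetric F L) (r : ℕ) (y : Y) :
    QuadraticForm ℝ (addTrivial L r y) :=
  (metricForm g y).prod (QuadraticMap.weightedSumSquares ℝ (fun _ : Fin r => (1 : ℝ)))

/-- The inclusion `(t, x) ↦ (t, (x, 0))` of `L + r` in `L + (r + 1)`, on the fibre at `y`. -/
def inclIsometry (g : ContinuousRiemannianMetric F L) (r : ℕ) (y : Y) :
    posForm g r y →qᵢ posForm g (r + 1) y where
  toFun t := (t.1, Fin.snoc t.2 0)
  map_add' s t := by
    refine Prod.ext rfl (funext fun i => ?_)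
    refine Fin.lastCases ?_ (fun i => ?_) i <;> simp
  map_smul' c t := by
    refine Prod.ext rfl (funext fun i => ?_)
    refine Fin.lastCases ?_ (fun i => ?_) i <;> simp
  map_app' t := by
    simp [posForm, QuadraticMap.weightedSumSquares_apply, Fin.sum_univ_castSucc]

theorem inclIsometry_apply (g : ContinuousRiemannianMetric F L) (r : ℕ) (y : Y)
    (t : addTrivial L r y) :
    inclIsometry g r y t = (t.1, (Fin.snoc t.2 0 : Fin (r + 1) → ℝ)) := rfl

theorem continuous_inclIsometry (g : ContinuousRiemannianMetric F L) (r : ℕ) :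
    Continuous (fun t : TotalSpace (F × (Fin r → ℝ)) (addTrivial L r) =>
      (⟨t.proj, inclIsometry g r t.proj t.snd⟩ :
        TotalSpace (F × (Fin (r + 1) → ℝ)) (addTrivial L (r + 1)))) := by
  have hind := FiberBundle.Prod.isInducing_diag F L (Fin r → ℝ) (Bundle.Trivial Y (Fin r → ℝ))
  rw [(FiberBundle.Prod.isInducing_diag F L (Fin (r + 1) → ℝ)
    (Bundle.Trivial Y (Fin (r + 1) → ℝ))).continuous_iff]
  refine (continuous_fst.comp hind.continuous).prodMk ?_
  rw [(Bundle.Trivial.isInducing_toProd Y (Fin (r + 1) → ℝ)).continuous_iff]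
  have h2 := (Bundle.Trivial.isInducing_toProd Y (Fin r → ℝ)).continuous.comp
    (continuous_snd.comp hind.continuous)
  refine (continuous_fst.comp h2).prodMk ?_
  refine continuous_pi fun i => ?_
  refine Fin.lastCases ?_ (fun i => ?_) i
  · simpa [inclIsometry_apply] using continuous_const (y := (0 : ℝ))
  · simpa [inclIsometry_apply, Function.comp_def] using
      (continuous_apply i).comp (continuous_snd.comp h2)

/-- The category of `𝕜`-vector bundles on `Y` with an action of `C⁻(L)`. -/
abbrev NegCliffordModules (𝕜 : Type) [RCLike 𝕜] (g : ContinuousRiemannianMetric F L) :=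
  CliffordModuleBundle.{u, v, w} 𝕜 F (negForm g)

/-- The category of `𝕜`-vector bundles on `Y` with an action of `C⁺(L + r)`. -/
abbrev PosCliffordModules (𝕜 : Type) [RCLike 𝕜] (g : ContinuousRiemannianMetric F L) (r : ℕ) :=
  CliffordModuleBundle.{u, v, w} 𝕜 (F × (Fin r → ℝ)) (posForm g r)

/-- The forgetful functor from `C⁻(L)`-module bundles to vector bundles. -/
abbrev forgetNeg (𝕜 : Type) [RCLike 𝕜] (g : ContinuousRiemannianMetric F L) :
    NegCliffordModules.{u, v, w} 𝕜 g ⥤ VecBundle.{u, v} 𝕜 Y :=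
  CliffordModuleBundle.forget 𝕜 F (negForm g)

/-- The forgetful functor from `C⁺(L + (r + 1))`-module bundles to `C⁺(L + r)`-module bundles. -/
abbrev forgetPos (𝕜 : Type) [RCLike 𝕜] (g : ContinuousRiemannianMetric F L) (r : ℕ) :
    PosCliffordModules.{u, v, w} 𝕜 g (r + 1) ⥤ PosCliffordModules.{u, v, w} 𝕜 g r :=
  CliffordModuleBundle.restrict 𝕜 (inclIsometry g r) (continuous_inclIsometry g r)

end Metric

end Clifford

/-! ### Topological K-theory of a functor -/

section KTheory

variable {C : Type*} [Category* C] [Preadditive C] [∀ X Y : C, TopologicalSpace (X ⟶ Y)]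
  {D : Type*} [Category* D] [Preadditive D] [∀ X Y : D, TopologicalSpace (X ⟶ Y)]

/-- The closed unit ball `Dⁿ` of `ℝⁿ`. -/
abbrev KBall (n : ℕ) := Metric.closedBall (0 : EuclideanSpace ℝ (Fin n)) 1

/-- The unit sphere `Sⁿ⁻¹` of `ℝⁿ` (empty for `n = 0`). -/
abbrev KSphere (n : ℕ) := Metric.sphere (0 : EuclideanSpace ℝ (Fin n)) 1

/-- The inclusion of the sphere in the ball. -/
def kSphereToBall {n : ℕ} (s : KSphere n) : KBall n := ⟨s.1, Metric.sphere_subset_closedBall s.2⟩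

/-- A continuous family, parametrized by `Dⁿ`, of isomorphisms `φ E ≅ φ F`, together with a lift of
its restriction to `Sⁿ⁻¹` to a continuous family of isomorphisms `E ≅ F`.  For `n = 0` this is an
isomorphism `φ E ≅ φ F`. -/
@[ext]
structure FamilyIso (φ : C ⥤ D) (n : ℕ) (E F : C) where
  /-- the family of isomorphisms on the ball -/
  onBall : KBall n → (φ.obj E ≅ φ.obj F)
  /-- the family of isomorphisms on the sphere -/
  onSphere : KSphere n → (E ≅ F)
  continuous_onBall_hom : Continuous (fun x => (onBall x).hom)
  continuous_onBall_inv : Continuous (fun x => (onBall x).inv)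
  continuous_onSphere_hom : Continuous (fun s => (onSphere s).hom)
  continuous_onSphere_inv : Continuous (fun s => (onSphere s).inv)
  compatible : ∀ s : KSphere n, φ.mapIso (onSphere s) = onBall (kSphereToBall s)

namespace FamilyIso

variable {φ : C ⥤ D} {n : ℕ}

/-- The constant family with value the identity of `E`. -/
def refl (φ : C ⥤ D) (n : ℕ) (E : C) : FamilyIso φ n E E where
  onBall _ := Iso.refl _
  onSphere _ := Iso.refl _
  continuous_onBall_hom := continuous_const
  continuous_onBall_inv := continuous_const
  continuous_onSphere_hom := continuous_const
  continuous_onSphere_inv := continuous_const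
  compatible _ := φ.mapIso_refl E

/-- Homotopy of families, through such families. -/
def Homotopic {E F : C} (a b : FamilyIso φ n E F) : Prop :=
  ∃ H : unitInterval → FamilyIso φ n E F, H 0 = a ∧ H 1 = b ∧
    Continuous (fun p : unitInterval × KBall n => ((H p.1).onBall p.2).hom) ∧
    Continuous (fun p : unitInterval × KBall n => ((H p.1).onBall p.2).inv) ∧
    Continuous (fun p : unitInterval × KSphere n => ((H p.1).onSphere p.2).hom) ∧
    Continuous (fun p : unitInterval × KSphere n => ((H p.1).onSphere p.2).inv)

end FamilyIso

/-- Triples `(E, F, α)`. -/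
structure KTriple (φ : C ⥤ D) (n : ℕ) where
  /-- the first object -/
  source : C
  /-- the second object -/
  target : C
  /-- the isomorphisms between them -/
  iso : FamilyIso φ n source target

/-- `X` is the direct sum of `X₁` and `X₂` in an additive category, by means of the given injections
and projections. -/
structure DirectSumData (X X₁ X₂ : C) where
  /-- the first injection -/
  inl : X₁ ⟶ X
  /-- the second injection -/
  inr : X₂ ⟶ X
  /-- the first projection -/
  fst : X ⟶ X₁
  /-- the second projection -/
  snd : X ⟶ X₂
  inl_fst : inl ≫ fst = 𝟙 X₁
  inr_snd : inr ≫ snd = 𝟙 X₂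
  inl_snd : inl ≫ snd = 0
  inr_fst : inr ≫ fst = 0
  total : fst ≫ inl + snd ≫ inr = 𝟙 X

namespace KTriple

variable {φ : C ⥤ D} {n : ℕ}

/-- Isomorphism of triples. -/
def Isomorphic (σ τ : KTriple φ n) : Prop :=
  ∃ (f : σ.source ≅ τ.source) (g : σ.target ≅ τ.target),
    (∀ x, (σ.iso.onBall x).hom ≫ φ.map g.hom = φ.map f.hom ≫ (τ.iso.onBall x).hom) ∧
    (∀ s, (σ.iso.onSphere s).hom ≫ g.hom = f.hom ≫ (τ.iso.onSphere s).hom)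

/-- The triple `σ` is a direct sum of `σ₁` and `σ₂`. -/
def IsDirectSum (σ σ₁ σ₂ : KTriple φ n) : Prop :=
  ∃ (a : DirectSumData σ.source σ₁.source σ₂.source)
    (b : DirectSumData σ.target σ₁.target σ₂.target),
    (∀ x, φ.map a.inl ≫ (σ.iso.onBall x).hom = (σ₁.iso.onBall x).hom ≫ φ.map b.inl) ∧
    (∀ x, φ.map a.inr ≫ (σ.iso.onBall x).hom = (σ₂.iso.onBall x).hom ≫ φ.map b.inr) ∧
    (∀ s, a.inl ≫ (σ.iso.onSphere s).hom = (σ₁.iso.onSphere s).hom ≫ b.inl) ∧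
    (∀ s, a.inr ≫ (σ.iso.onSphere s).hom = (σ₂.iso.onSphere s).hom ≫ b.inr)

/-- The relations of the K-group of a functor: isomorphic triples are equal, direct sums are sums,
and the elementary triples `(E, E, α)` with `α` homotopic to the identity are zero. -/
inductive Relation (φ : C ⥤ D) (n : ℕ) : FreeAbelianGroup (KTriple φ n) → Prop
  | isomorphic (σ τ : KTriple φ n) (h : σ.Isomorphic τ) :
      Relation φ n (FreeAbelianGroup.of σ - FreeAbelianGroup.of τ)
  | directSum (σ σ₁ σ₂ : KTriple φ n) (h : σ.IsDirectSum σ₁ σ₂) :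
      Relation φ n (FreeAbelianGroup.of σ - (FreeAbelianGroup.of σ₁ + FreeAbelianGroup.of σ₂))
  | elementary (E : C) (α : FamilyIso φ n E E) (h : α.Homotopic (FamilyIso.refl φ n E)) :
      Relation φ n (FreeAbelianGroup.of ⟨E, E, α⟩)

end KTriple

/-- The group `K_n(φ)`, `n ≥ 0`, of an additive functor `φ : C → D` of categories enriched in
topological spaces (such as Banach categories).  For `n = 0` it is the Grothendieck group of `φ`:
triples `(E, F, α : φ E ≅ φ F)` modulo isomorphism, direct sum and elementary triples.  In general it
is the relative group over `(Dⁿ, Sⁿ⁻¹)`, i.e. the Grothendieck group of the functor from `C(Dⁿ)` to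
the fibre product of `C(Sⁿ⁻¹)` and `D(Dⁿ)` over `D(Sⁿ⁻¹)`, where `C(X)` is the category of families
of objects of `C` parametrized by `X` (direct factors of constant ones).  As `Dⁿ` is contractible, for
a pseudo-abelian Banach category `C`, such as the categories of module bundles on a compact space,
every such family on `Dⁿ` is isomorphic to a constant one, so only constant ones are used. -/
abbrev KGroupNat (φ : C ⥤ D) [φ.Additive] (n : ℕ) :=
  FreeAbelianGroup (KTriple φ n) ⧸ AddSubgroup.closure {z | KTriple.Relation φ n z}

/-- The group `K_i(φ) = K^{-i}(φ)`, `i ∈ ℤ`.  For negative `i` it is defined, as usual, by Bott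
periodicity: `K_i = K_{i + 8k}`, with the representative of `i` modulo `8` in `{0, …, 7}`. -/
abbrev KGroup (φ : C ⥤ D) [φ.Additive] (i : ℤ) :=
  KGroupNat φ (if 0 ≤ i then i else i % 8).toNat

end KTheory

end

noncomputable section

/-! ### Invariance of the K-groups of a functor under equivalences -/

section KInvariance

set_option linter.unusedSectionVars false

/-! The theorem is a Morita equivalence. Let e₁, e₂ be the unit vectors of the trivial summand of L
+ 2. Since L has rank one, C⁺(L + 1) is the endomorphism bundle of ℝ ⊕ L, so its modules amount to
plain vector bundles: to M corresponds the part M⁺ fixed by e₁ (`positivePart`). A nonzero t in L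
anticommutes with e₁, so it exchanges M⁺ and M⁻. Hence a map h : M⁺ → N⁺ has exactly one extension
commuting with the action, namely ĥ + |t|⁻² t ĥ t, where ĥ is h extended by zero to M⁻. This formula
does not change when t is rescaled, so local choices of t glue although L need not have a global
nonvanishing section.

In C⁺(L + 2) the elements t e₁ e₂ are central and have square -|t|². They generate a copy of C⁻(L),
and C⁺(L + 2) is the tensor product of C⁺(L + 1) and C⁻(L). So the positive part of a C⁺(L +
2)-module is a C⁻(L)-module (`negPart`), t acting by -t e₂ because e₁ = 1 there. This functor is
fully faithful, as e₂ can be recovered from the action of C⁻(L) (`ExtraUnit.app_hom_of_negPart`),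
and essentially surjective, as N is the positive part of a C⁺(L + 2)-structure on N ⊕ N
(`negPartDoubleIso`).

Taking positive parts turns the restriction functor from C⁺(L + 2) to C⁺(L + 1) into the forgetful
functor from C⁻(L)-modules to bundles (`negPartForgetIso`). The K-groups do not change along such a
square (`KGroupNat.equivOfSquare`), provided that the functors are homeomorphisms on spaces of
morphisms, so that continuous families and homotopies go both ways. For this, composition need only
be continuous in each variable, since families are only ever composed with fixed isomorphisms. The
isomorphism exists for every n ≥ 0, which includes the representatives used for negative i. -/

/-- Composition is continuous in each variable. -/
class SeparatelyContinuousComp (C : Type*) [Category* C] [∀ X Y : C, TopologicalSpace (X ⟶ Y)] :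
    Prop where
  continuous_comp_left {X Y Z : C} (f : X ⟶ Y) : Continuous (fun h : Y ⟶ Z => f ≫ h)
  continuous_comp_right {X Y Z : C} (h : Y ⟶ Z) : Continuous (fun f : X ⟶ Y => f ≫ h)

/-- A functor which is a homeomorphism on all spaces of morphisms. -/
class IsHomHomeomorph {C D : Type*} [Category* C] [Category* D]
    [∀ X Y : C, TopologicalSpace (X ⟶ Y)] [∀ X Y : D, TopologicalSpace (X ⟶ Y)]
    (G : C ⥤ D) : Prop where
  isHomeomorph (X Y : C) : IsHomeomorph (fun f : X ⟶ Y => G.map f)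

section HomHomeomorph

variable {C D : Type*} [Category* C] [Category* D]
    [∀ X Y : C, TopologicalSpace (X ⟶ Y)] [∀ X Y : D, TopologicalSpace (X ⟶ Y)]
    (G : C ⥤ D) [IsHomHomeomorph G]

instance : G.Faithful where
  map_injective {X Y} _ _ h := (IsHomHomeomorph.isHomeomorph (G := G) X Y).injective h

instance : G.Full where
  map_surjective {X Y} f := (IsHomHomeomorph.isHomeomorph (G := G) X Y).surjective f

theorem IsHomHomeomorph.continuous_map (X Y : C) : Continuous (fun f : X ⟶ Y => G.map f) :=
  (isHomeomorph X Y).continuous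

theorem IsHomHomeomorph.continuous_iff {Z : Type*} [TopologicalSpace Z] {X Y : C}
    {h : Z → (X ⟶ Y)} : Continuous h ↔ Continuous (fun z => G.map (h z)) :=
  (isHomeomorph (G := G) X Y).isInducing.continuous_iff

end HomHomeomorph

namespace SeparatelyContinuousComp

variable {C : Type*} [Category* C] [∀ X Y : C, TopologicalSpace (X ⟶ Y)]
  [SeparatelyContinuousComp C] {Z : Type*} [TopologicalSpace Z]

theorem comp_left {X Y W : C} (f : X ⟶ Y) {h : Z → (Y ⟶ W)} (hh : Continuous h) :
    Continuous (fun z => f ≫ h z) :=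
  (continuous_comp_left f).comp hh

theorem comp_right {X Y W : C} (f : Y ⟶ W) {h : Z → (X ⟶ Y)} (hh : Continuous h) :
    Continuous (fun z => h z ≫ f) :=
  (continuous_comp_right f).comp hh

end SeparatelyContinuousComp

namespace KTriple

variable {C : Type*} [Category* C] [Preadditive C] [∀ X Y : C, TopologicalSpace (X ⟶ Y)]
  {D : Type*} [Category* D] [Preadditive D] [∀ X Y : D, TopologicalSpace (X ⟶ Y)]
  {φ : C ⥤ D} {n : ℕ}

theorem Isomorphic.refl (σ : KTriple φ n) : σ.Isomorphic σ :=
  ⟨Iso.refl _, Iso.refl _, fun x => by simp, fun s => by simp⟩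

/-- The class of a triple in the K-group. -/
def cls [φ.Additive] (σ : KTriple φ n) : KGroupNat φ n :=
  QuotientAddGroup.mk (FreeAbelianGroup.of σ)

theorem cls_eq_of_isomorphic [φ.Additive] {σ τ : KTriple φ n} (h : σ.Isomorphic τ) :
    σ.cls = τ.cls := by
  have h1 := (QuotientAddGroup.eq_zero_iff _).2
    (AddSubgroup.subset_closure (Relation.isomorphic σ τ h))
  rw [QuotientAddGroup.mk_sub] at h1
  exact sub_eq_zero.1 h1

theorem cls_eq_add [φ.Additive] {σ σ₁ σ₂ : KTriple φ n} (h : σ.IsDirectSum σ₁ σ₂) :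
    σ.cls = σ₁.cls + σ₂.cls := by
  have h1 := (QuotientAddGroup.eq_zero_iff _).2
    (AddSubgroup.subset_closure (Relation.directSum σ σ₁ σ₂ h))
  rw [QuotientAddGroup.mk_sub] at h1
  exact sub_eq_zero.1 h1

theorem cls_eq_zero [φ.Additive] {E : C} {α : FamilyIso φ n E E}
    (h : α.Homotopic (FamilyIso.refl φ n E)) : (⟨E, E, α⟩ : KTriple φ n).cls = 0 :=
  (QuotientAddGroup.eq_zero_iff _).2 (AddSubgroup.subset_closure (Relation.elementary E α h))

end KTriple

/-- A homomorphism on the K-group of a functor is given by an additive invariant of triples. -/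
def KGroupNat.lift {C : Type*} [Category* C] [Preadditive C] [∀ X Y : C, TopologicalSpace (X ⟶ Y)]
    {D : Type*} [Category* D] [Preadditive D] [∀ X Y : D, TopologicalSpace (X ⟶ Y)]
    {φ : C ⥤ D} [φ.Additive] {n : ℕ} {A : Type*} [AddCommGroup A] (f : KTriple φ n → A)
    (h_iso : ∀ σ τ, σ.Isomorphic τ → f σ = f τ)
    (h_sum : ∀ σ σ₁ σ₂, σ.IsDirectSum σ₁ σ₂ → f σ = f σ₁ + f σ₂)
    (h_zero : ∀ (E : C) (α : FamilyIso φ n E E), α.Homotopic (FamilyIso.refl φ n E) →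
      f ⟨E, E, α⟩ = 0) : KGroupNat φ n →+ A :=
  QuotientAddGroup.lift _ (FreeAbelianGroup.lift f) (by
    rw [AddSubgroup.closure_le]
    rintro _ (⟨σ, τ, h⟩ | ⟨σ, σ₁, σ₂, h⟩ | ⟨E, α, h⟩)
    · simp [AddMonoidHom.mem_ker, h_iso σ τ h]
    · simp [AddMonoidHom.mem_ker, h_sum _ _ _ h]
    · simp [AddMonoidHom.mem_ker, h_zero _ _ h])

/-! ### Triples that correspond under a square of functors -/

section Square

variable {C : Type*} [Category* C] [Preadditive C] [∀ X Y : C, TopologicalSpace (X ⟶ Y)]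
  {D : Type*} [Category* D] [Preadditive D] [∀ X Y : D, TopologicalSpace (X ⟶ Y)]
  {C' : Type*} [Category* C'] [Preadditive C'] [∀ X Y : C', TopologicalSpace (X ⟶ Y)]
  {D' : Type*} [Category* D'] [Preadditive D'] [∀ X Y : D', TopologicalSpace (X ⟶ Y)]
  {φ : C ⥤ D} {φ' : C' ⥤ D'} {G : C ⥤ C'} {G₀ : D ⥤ D'}

@[simp]
theorem KGroupNat.lift_cls [φ.Additive] {n : ℕ} {A : Type*} [AddCommGroup A] (f : KTriple φ n → A)
    (h_iso : ∀ σ τ, σ.Isomorphic τ → f σ = f τ)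
    (h_sum : ∀ σ σ₁ σ₂, σ.IsDirectSum σ₁ σ₂ → f σ = f σ₁ + f σ₂)
    (h_zero : ∀ (E : C) (α : FamilyIso φ n E E), α.Homotopic (FamilyIso.refl φ n E) →
      f ⟨E, E, α⟩ = 0) (σ : KTriple φ n) :
    KGroupNat.lift f h_iso h_sum h_zero σ.cls = f σ :=
  FreeAbelianGroup.lift_apply_of f σ

theorem KGroupNat.hom_ext [φ.Additive] {n : ℕ} {A : Type*} [AddCommGroup A]
    {f g : KGroupNat φ n →+ A} (h : ∀ σ : KTriple φ n, f σ.cls = g σ.cls) : f = g :=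
  QuotientAddGroup.addMonoidHom_ext _ (FreeAbelianGroup.lift_ext _ _ fun σ => h σ)

variable (η : φ ⋙ G₀ ≅ G ⋙ φ') {n : ℕ}

/-- The triple `τ` is the image of `σ` under the pair of functors `(G, G₀)`, up to isomorphisms. -/
def KTriple.Corresponds (σ : KTriple φ n) (τ : KTriple φ' n) : Prop :=
  ∃ (a : G.obj σ.source ≅ τ.source) (b : G.obj σ.target ≅ τ.target),
    (∀ x, G₀.map (σ.iso.onBall x).hom ≫ η.hom.app σ.target ≫ φ'.map b.hom =
      η.hom.app σ.source ≫ φ'.map a.hom ≫ (τ.iso.onBall x).hom) ∧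
    (∀ s, G.map (σ.iso.onSphere s).hom ≫ b.hom = a.hom ≫ (τ.iso.onSphere s).hom)

theorem map_map_comp_app {E F : C} (f : E ⟶ F) :
    G₀.map (φ.map f) ≫ η.hom.app F = η.hom.app E ≫ φ'.map (G.map f) := η.hom.naturality f

theorem map_map_comp_app_assoc {E F : C} (f : E ⟶ F) {X : D'} (k : φ'.obj (G.obj F) ⟶ X) :
    G₀.map (φ.map f) ≫ η.hom.app F ≫ k = η.hom.app E ≫ φ'.map (G.map f) ≫ k := by
  rw [← Category.assoc, map_map_comp_app, Category.assoc]

section Push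

variable [IsHomHomeomorph G] [IsHomHomeomorph G₀] [SeparatelyContinuousComp D']

/-- The image of a family of isomorphisms under a pair of functors. -/
def FamilyIso.push {E F : C} (α : FamilyIso φ n E F) :
    FamilyIso φ' n (G.obj E) (G.obj F) where
  onBall x := (η.app E).symm ≪≫ G₀.mapIso (α.onBall x) ≪≫ η.app F
  onSphere s := G.mapIso (α.onSphere s)
  continuous_onBall_hom := SeparatelyContinuousComp.comp_left _
    (SeparatelyContinuousComp.comp_right _
      ((IsHomHomeomorph.continuous_map G₀ _ _).comp α.continuous_onBall_hom))
  continuous_onBall_inv := SeparatelyContinuousComp.comp_right _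
    (SeparatelyContinuousComp.comp_left _
      ((IsHomHomeomorph.continuous_map G₀ _ _).comp α.continuous_onBall_inv))
  continuous_onSphere_hom := (IsHomHomeomorph.continuous_map G _ _).comp α.continuous_onSphere_hom
  continuous_onSphere_inv := (IsHomHomeomorph.continuous_map G _ _).comp α.continuous_onSphere_inv
  compatible s := by
    ext
    simp [← α.compatible s, map_map_comp_app]

theorem FamilyIso.push_refl (E : C) :
    FamilyIso.push η (FamilyIso.refl φ n E) = FamilyIso.refl φ' n (G.obj E) := by
  ext x <;> simp [push, refl]

theorem FamilyIso.Homotopic.push {E F : C} {α β : FamilyIso φ n E F} (h : α.Homotopic β) :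
    (α.push η).Homotopic (β.push η) := by
  obtain ⟨H, h0, h1, c1, c2, c3, c4⟩ := h
  refine ⟨fun t => (H t).push η, by simp only [h0], by simp only [h1], ?_, ?_, ?_, ?_⟩
  · exact SeparatelyContinuousComp.comp_left _ (SeparatelyContinuousComp.comp_right _
      ((IsHomHomeomorph.continuous_map G₀ _ _).comp c1))
  · exact SeparatelyContinuousComp.comp_right _ (SeparatelyContinuousComp.comp_left _
      ((IsHomHomeomorph.continuous_map G₀ _ _).comp c2))
  · exact (IsHomHomeomorph.continuous_map G _ _).comp c3
  · exact (IsHomHomeomorph.continuous_map G _ _).comp c4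

theorem KTriple.corresponds_push {E F : C} (α : FamilyIso φ n E F) :
    Corresponds η ⟨E, F, α⟩ ⟨G.obj E, G.obj F, α.push η⟩ :=
  ⟨Iso.refl _, Iso.refl _, fun x => by simp [FamilyIso.push], fun s => by simp [FamilyIso.push]⟩

end Push

section Pull

variable [IsHomHomeomorph G] [IsHomHomeomorph G₀] [SeparatelyContinuousComp C']
  [SeparatelyContinuousComp D']

/-- The preimage of a family of isomorphisms under a pair of fully faithful functors. -/
def FamilyIso.pull {E F : C} {E' F' : C'} (a : G.obj E ≅ E') (b : G.obj F ≅ F')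
    (β : FamilyIso φ' n E' F') : FamilyIso φ n E F where
  onBall x := G₀.preimageIso
    (η.app E ≪≫ φ'.mapIso a ≪≫ β.onBall x ≪≫ φ'.mapIso b.symm ≪≫ (η.app F).symm)
  onSphere s := G.preimageIso (a ≪≫ β.onSphere s ≪≫ b.symm)
  continuous_onBall_hom := by
    -- The preimages are not given by a formula; their continuity is tested after applying `G₀`,
    -- which is inducing on morphisms.
    rw [IsHomHomeomorph.continuous_iff G₀]
    simp only [Functor.preimageIso_hom, Functor.map_preimage, Iso.trans_hom]
    exact SeparatelyContinuousComp.comp_left _ (SeparatelyContinuousComp.comp_left _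
      (SeparatelyContinuousComp.comp_right _ β.continuous_onBall_hom))
  continuous_onBall_inv := by
    rw [IsHomHomeomorph.continuous_iff G₀]
    simp only [Functor.preimageIso_inv, Functor.map_preimage, Iso.trans_inv]
    exact SeparatelyContinuousComp.comp_right _ (SeparatelyContinuousComp.comp_right _
      (SeparatelyContinuousComp.comp_left _ β.continuous_onBall_inv))
  continuous_onSphere_hom := by
    rw [IsHomHomeomorph.continuous_iff G]
    simp only [Functor.preimageIso_hom, Functor.map_preimage, Iso.trans_hom]
    exact SeparatelyContinuousComp.comp_left _
      (SeparatelyContinuousComp.comp_right _ β.continuous_onSphere_hom)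
  continuous_onSphere_inv := by
    rw [IsHomHomeomorph.continuous_iff G]
    simp only [Functor.preimageIso_inv, Functor.map_preimage, Iso.trans_inv]
    exact SeparatelyContinuousComp.comp_right _
      (SeparatelyContinuousComp.comp_left _ β.continuous_onSphere_inv)
  compatible s := by
    ext
    apply G₀.map_injective
    rw [← cancel_mono (η.hom.app F)]
    simp [← β.compatible s, map_map_comp_app]

theorem FamilyIso.pull_refl {E : C} {E' : C'} (a : G.obj E ≅ E') :
    FamilyIso.pull η a a (FamilyIso.refl φ' n E') = FamilyIso.refl φ n E := by
  ext x
  · apply G₀.map_injective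
    simp [pull, refl]
  · apply G.map_injective
    simp [pull, refl]

theorem FamilyIso.Homotopic.pull {E F : C} {E' F' : C'} (a : G.obj E ≅ E') (b : G.obj F ≅ F')
    {α β : FamilyIso φ' n E' F'} (h : α.Homotopic β) :
    (FamilyIso.pull η a b α).Homotopic (FamilyIso.pull η a b β) := by
  obtain ⟨H, h0, h1, c1, c2, c3, c4⟩ := h
  refine ⟨fun t => (H t).pull η a b, by simp only [h0], by simp only [h1], ?_, ?_, ?_, ?_⟩
  · rw [IsHomHomeomorph.continuous_iff G₀]
    simp only [FamilyIso.pull, Functor.preimageIso_hom, Functor.map_preimage, Iso.trans_hom]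
    exact SeparatelyContinuousComp.comp_left _ (SeparatelyContinuousComp.comp_left _
      (SeparatelyContinuousComp.comp_right _ c1))
  · rw [IsHomHomeomorph.continuous_iff G₀]
    simp only [FamilyIso.pull, Functor.preimageIso_inv, Functor.map_preimage, Iso.trans_inv]
    exact SeparatelyContinuousComp.comp_right _ (SeparatelyContinuousComp.comp_right _
      (SeparatelyContinuousComp.comp_left _ c2))
  · rw [IsHomHomeomorph.continuous_iff G]
    simp only [FamilyIso.pull, Functor.preimageIso_hom, Functor.map_preimage, Iso.trans_hom]
    exact SeparatelyContinuousComp.comp_left _ (SeparatelyContinuousComp.comp_right _ c3)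
  · rw [IsHomHomeomorph.continuous_iff G]
    simp only [FamilyIso.pull, Functor.preimageIso_inv, Functor.map_preimage, Iso.trans_inv]
    exact SeparatelyContinuousComp.comp_right _ (SeparatelyContinuousComp.comp_left _ c4)

theorem KTriple.corresponds_pull {E F : C} {E' F' : C'} (a : G.obj E ≅ E') (b : G.obj F ≅ F')
    (β : FamilyIso φ' n E' F') : Corresponds η ⟨E, F, β.pull η a b⟩ ⟨E', F', β⟩ :=
  ⟨a, b, fun x => by simp [FamilyIso.pull, ← Functor.map_comp], fun s => by simp [FamilyIso.pull]⟩

end Pull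

namespace KTriple.Corresponds

variable {η} {σ σ₁ σ₂ : KTriple φ n} {τ τ₁ τ₂ : KTriple φ' n}

/-- Conjugating by the isomorphisms of the two correspondences carries one isomorphism of triples to
the other. With σ₁ = σ₂ it shows that the class of a corresponding triple is well defined, so
correspondents may be chosen arbitrarily. -/
theorem isomorphic (h₁ : Corresponds η σ₁ τ₁) (h₂ : Corresponds η σ₂ τ₂)
    (h : σ₁.Isomorphic σ₂) : τ₁.Isomorphic τ₂ := by
  obtain ⟨a₁, b₁, hb₁, hs₁⟩ := h₁
  obtain ⟨a₂, b₂, hb₂, hs₂⟩ := h₂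
  obtain ⟨f, k, hb, hs⟩ := h
  refine ⟨a₁.symm ≪≫ G.mapIso f ≪≫ a₂, b₁.symm ≪≫ G.mapIso k ≪≫ b₂, fun x => ?_, fun s => ?_⟩
  -- Precomposing with these isomorphisms produces the right side of `hb₁`, so the family of τ₁ can
  -- be traded for that of σ₁.
  · rw [← cancel_epi (φ'.map a₁.hom), ← cancel_epi (η.hom.app σ₁.source)]
    have h1 := reassoc_of% (hb₁ x)
    have h2 := congrArg (fun z => G₀.map z ≫ η.hom.app _ ≫ φ'.map b₂.hom) (hb x)
    simp only [Functor.map_comp, Category.assoc, map_map_comp_app_assoc, hb₂] at h2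
    simpa [← h1] using h2
  · rw [← cancel_epi a₁.hom]
    have h1 := reassoc_of% (hs₁ s)
    have h2 := congrArg (fun z => G.map z ≫ b₂.hom) (hs s)
    simp only [Functor.map_comp, Category.assoc, hs₂] at h2
    simpa [← h1] using h2

/-- Fullness of `G` supplies the isomorphisms; faithfulness of `G₀` and of `G` gives the
compatibility on the ball and on the sphere. -/
theorem isomorphic_reflect [IsHomHomeomorph G] [IsHomHomeomorph G₀]
    (h₁ : Corresponds η σ₁ τ₁) (h₂ : Corresponds η σ₂ τ₂)
    (h : τ₁.Isomorphic τ₂) : σ₁.Isomorphic σ₂ := by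
  obtain ⟨a₁, b₁, hb₁, hs₁⟩ := h₁
  obtain ⟨a₂, b₂, hb₂, hs₂⟩ := h₂
  obtain ⟨f, k, hb, hs⟩ := h
  refine ⟨G.preimageIso (a₁ ≪≫ f ≪≫ a₂.symm), G.preimageIso (b₁ ≪≫ k ≪≫ b₂.symm),
    fun x => ?_, fun s => ?_⟩
  · apply G₀.map_injective
    rw [← cancel_mono (η.hom.app σ₂.target), ← cancel_mono (φ'.map b₂.hom)]
    have h1 := reassoc_of% (hb₁ x)
    simp only [Functor.map_comp, Category.assoc, map_map_comp_app_assoc, hb₂]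
    simp [h1, hb x]
  · apply G.map_injective
    rw [← cancel_mono b₂.hom]
    have h1 := reassoc_of% (hs₁ s)
    simp [hs₂, h1, hs s]

end KTriple.Corresponds

/-- The image of a direct sum under an additive functor, transported along isomorphisms. -/
def DirectSumData.push {C C' : Type*} [Category* C] [Preadditive C] [Category* C'] [Preadditive C']
    (G : C ⥤ C') [G.Additive]
    {X X₁ X₂ : C} {X' X₁' X₂' : C'} (e : G.obj X ≅ X') (e₁ : G.obj X₁ ≅ X₁')
    (e₂ : G.obj X₂ ≅ X₂') (d : DirectSumData X X₁ X₂) : DirectSumData X' X₁' X₂' where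
  inl := e₁.inv ≫ G.map d.inl ≫ e.hom
  inr := e₂.inv ≫ G.map d.inr ≫ e.hom
  fst := e.inv ≫ G.map d.fst ≫ e₁.hom
  snd := e.inv ≫ G.map d.snd ≫ e₂.hom
  inl_fst := by simp [← Functor.map_comp_assoc, d.inl_fst]
  inr_snd := by simp [← Functor.map_comp_assoc, d.inr_snd]
  inl_snd := by simp [← Functor.map_comp_assoc, d.inl_snd]
  inr_fst := by simp [← Functor.map_comp_assoc, d.inr_fst]
  total := by
    have h := congrArg (fun z => e.inv ≫ G.map z ≫ e.hom) d.total
    simpa using h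

/-- A direct sum in the target of a fully faithful additive functor comes from the source. -/
def DirectSumData.pull {C C' : Type*} [Category* C] [Preadditive C] [Category* C'] [Preadditive C']
    (G : C ⥤ C') [G.Additive] [G.Full] [G.Faithful]
    {X X₁ X₂ : C} {X' X₁' X₂' : C'} (e : G.obj X ≅ X') (e₁ : G.obj X₁ ≅ X₁')
    (e₂ : G.obj X₂ ≅ X₂') (d : DirectSumData X' X₁' X₂') : DirectSumData X X₁ X₂ where
  inl := G.preimage (e₁.hom ≫ d.inl ≫ e.inv)
  inr := G.preimage (e₂.hom ≫ d.inr ≫ e.inv)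
  fst := G.preimage (e.hom ≫ d.fst ≫ e₁.inv)
  snd := G.preimage (e.hom ≫ d.snd ≫ e₂.inv)
  inl_fst := G.map_injective (by simp [reassoc_of% d.inl_fst])
  inr_snd := G.map_injective (by simp [reassoc_of% d.inr_snd])
  inl_snd := G.map_injective (by simp [reassoc_of% d.inl_snd])
  inr_fst := G.map_injective (by simp [reassoc_of% d.inr_fst])
  total := G.map_injective (by
    have h := congrArg (fun z => e.hom ≫ z ≫ e.inv) d.total
    simpa using h)

namespace KTriple.Corresponds

variable {η} {σ σ₁ σ₂ : KTriple φ n} {τ τ₁ τ₂ : KTriple φ' n} [G.Additive]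

theorem isDirectSum (h : Corresponds η σ τ) (h₁ : Corresponds η σ₁ τ₁) (h₂ : Corresponds η σ₂ τ₂)
    (hd : σ.IsDirectSum σ₁ σ₂) : τ.IsDirectSum τ₁ τ₂ := by
  obtain ⟨e, f, hb, hs⟩ := h
  obtain ⟨e₁, f₁, hb₁, hs₁⟩ := h₁
  obtain ⟨e₂, f₂, hb₂, hs₂⟩ := h₂
  obtain ⟨p, q, hl, hr, hl', hr'⟩ := hd
  refine ⟨p.push G e e₁ e₂, q.push G f f₁ f₂, fun x => ?_, fun x => ?_, fun s => ?_, fun s => ?_⟩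
  · rw [← cancel_epi (φ'.map e₁.hom), ← cancel_epi (η.hom.app σ₁.source)]
    have h1 := reassoc_of% (hb₁ x)
    have h2 := congrArg (fun z => G₀.map z ≫ η.hom.app _ ≫ φ'.map f.hom) (hl x)
    simp only [Functor.map_comp, Category.assoc, map_map_comp_app_assoc, hb] at h2
    simpa [← h1, DirectSumData.push] using h2
  · rw [← cancel_epi (φ'.map e₂.hom), ← cancel_epi (η.hom.app σ₂.source)]
    have h1 := reassoc_of% (hb₂ x)
    have h2 := congrArg (fun z => G₀.map z ≫ η.hom.app _ ≫ φ'.map f.hom) (hr x)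
    simp only [Functor.map_comp, Category.assoc, map_map_comp_app_assoc, hb] at h2
    simpa [← h1, DirectSumData.push] using h2
  · rw [← cancel_epi e₁.hom]
    have h1 := reassoc_of% (hs₁ s)
    have h2 := congrArg (fun z => G.map z ≫ f.hom) (hl' s)
    simp only [Functor.map_comp, Category.assoc, hs] at h2
    simpa [← h1, DirectSumData.push] using h2
  · rw [← cancel_epi e₂.hom]
    have h1 := reassoc_of% (hs₂ s)
    have h2 := congrArg (fun z => G.map z ≫ f.hom) (hr' s)
    simp only [Functor.map_comp, Category.assoc, hs] at h2
    simpa [← h1, DirectSumData.push] using h2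

/-- A direct sum is encoded by equations between injections and projections, which a fully faithful
additive functor reflects. No biproducts have to exist in either category. -/
theorem isDirectSum_reflect [IsHomHomeomorph G] [IsHomHomeomorph G₀]
    (h : Corresponds η σ τ) (h₁ : Corresponds η σ₁ τ₁) (h₂ : Corresponds η σ₂ τ₂)
    (hd : τ.IsDirectSum τ₁ τ₂) : σ.IsDirectSum σ₁ σ₂ := by
  obtain ⟨e, f, hb, hs⟩ := h
  obtain ⟨e₁, f₁, hb₁, hs₁⟩ := h₁
  obtain ⟨e₂, f₂, hb₂, hs₂⟩ := h₂
  obtain ⟨p, q, hl, hr, hl', hr'⟩ := hd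
  refine ⟨p.pull G e e₁ e₂, q.pull G f f₁ f₂, fun x => ?_, fun x => ?_, fun s => ?_, fun s => ?_⟩
  · apply G₀.map_injective
    rw [← cancel_mono (η.hom.app σ.target), ← cancel_mono (φ'.map f.hom)]
    have h1 := reassoc_of% (hb₁ x)
    simp only [Functor.map_comp, Category.assoc, map_map_comp_app_assoc, hb]
    simp [h1, ← hl x, DirectSumData.pull]
  · apply G₀.map_injective
    rw [← cancel_mono (η.hom.app σ.target), ← cancel_mono (φ'.map f.hom)]
    have h1 := reassoc_of% (hb₂ x)
    simp only [Functor.map_comp, Category.assoc, map_map_comp_app_assoc, hb]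
    simp [h1, ← hr x, DirectSumData.pull]
  · apply G.map_injective
    rw [← cancel_mono f.hom]
    have h1 := reassoc_of% (hs₁ s)
    simp [hs, h1, ← hl' s, DirectSumData.pull]
  · apply G.map_injective
    rw [← cancel_mono f.hom]
    have h1 := reassoc_of% (hs₂ s)
    simp [hs, h1, ← hr' s, DirectSumData.pull]

end KTriple.Corresponds

/-! ### The induced isomorphism of K-groups -/

section Equiv

variable [φ.Additive] [φ'.Additive] [G.Additive] [G.EssSurj] [IsHomHomeomorph G]
  [IsHomHomeomorph G₀] [SeparatelyContinuousComp C'] [SeparatelyContinuousComp D']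

theorem KTriple.exists_corresponds_right (σ : KTriple φ n) : ∃ τ, Corresponds η σ τ :=
  ⟨_, corresponds_push η σ.iso⟩

/-- Only `G` has to be essentially surjective: the two objects of a triple lie in the source
category, and `G₀` serves merely to pull back isomorphisms between their images. -/
theorem KTriple.exists_corresponds_left (τ : KTriple φ' n) : ∃ σ, Corresponds η σ τ :=
  ⟨_, corresponds_pull η (G.objObjPreimageIso _) (G.objObjPreimageIso _) τ.iso⟩

/-- The map of K-groups induced by a square of functors. -/
def KGroupNat.map : KGroupNat φ n →+ KGroupNat φ' n :=
  KGroupNat.lift (fun σ => (KTriple.exists_corresponds_right η σ).choose.cls)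
    (fun σ τ h => KTriple.cls_eq_of_isomorphic
      ((KTriple.exists_corresponds_right η σ).choose_spec.isomorphic
        (KTriple.exists_corresponds_right η τ).choose_spec h))
    (fun σ σ₁ σ₂ h => KTriple.cls_eq_add
      ((KTriple.exists_corresponds_right η σ).choose_spec.isDirectSum
        (KTriple.exists_corresponds_right η σ₁).choose_spec
        (KTriple.exists_corresponds_right η σ₂).choose_spec h))
    (fun E α h => by
      -- The chosen correspondent need not have equal source and target, so it is compared with the
      -- pushed triple, which is elementary.
      have h1 := h.push η
      rw [FamilyIso.push_refl] at h1
      rw [← KTriple.cls_eq_zero h1]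
      exact KTriple.cls_eq_of_isomorphic
        ((KTriple.exists_corresponds_right η _).choose_spec.isomorphic
          (KTriple.corresponds_push η α) (KTriple.Isomorphic.refl _)))

theorem KGroupNat.map_cls {σ : KTriple φ n} {τ : KTriple φ' n} (h : KTriple.Corresponds η σ τ) :
    KGroupNat.map η σ.cls = τ.cls := by
  rw [KGroupNat.map, KGroupNat.lift_cls]
  exact KTriple.cls_eq_of_isomorphic
    ((KTriple.exists_corresponds_right η σ).choose_spec.isomorphic h (KTriple.Isomorphic.refl _))

/-- The inverse of the map of K-groups induced by a square of functors. -/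
def KGroupNat.comap : KGroupNat φ' n →+ KGroupNat φ n :=
  KGroupNat.lift (fun τ => (KTriple.exists_corresponds_left η τ).choose.cls)
    (fun σ τ h => KTriple.cls_eq_of_isomorphic
      ((KTriple.exists_corresponds_left η σ).choose_spec.isomorphic_reflect
        (KTriple.exists_corresponds_left η τ).choose_spec h))
    (fun σ σ₁ σ₂ h => KTriple.cls_eq_add
      ((KTriple.exists_corresponds_left η σ).choose_spec.isDirectSum_reflect
        (KTriple.exists_corresponds_left η σ₁).choose_spec
        (KTriple.exists_corresponds_left η σ₂).choose_spec h))
    (fun E α h => by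
      -- The same isomorphism is used at both ends, so that the identity family is pulled back to
      -- the identity family.
      have h1 := h.pull η (G.objObjPreimageIso E) (G.objObjPreimageIso E)
      rw [FamilyIso.pull_refl] at h1
      rw [← KTriple.cls_eq_zero h1]
      exact KTriple.cls_eq_of_isomorphic
        ((KTriple.exists_corresponds_left η _).choose_spec.isomorphic_reflect
          (KTriple.corresponds_pull η _ _ α) (KTriple.Isomorphic.refl _)))

theorem KGroupNat.comap_cls {σ : KTriple φ n} {τ : KTriple φ' n}
    (h : KTriple.Corresponds η σ τ) : KGroupNat.comap η τ.cls = σ.cls := by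
  rw [KGroupNat.comap, KGroupNat.lift_cls]
  exact KTriple.cls_eq_of_isomorphic
    ((KTriple.exists_corresponds_left η τ).choose_spec.isomorphic_reflect h
      (KTriple.Isomorphic.refl _))

/-- The K-groups of two functors `φ : C ⥤ D` and `φ' : C' ⥤ D'` are isomorphic if there are an
equivalence `G : C ⥤ C'` and a fully faithful functor `G₀ : D ⥤ D'`, homeomorphic on morphisms and
compatible with `φ` and `φ'`. -/
def KGroupNat.equivOfSquare (n : ℕ) : KGroupNat φ n ≃+ KGroupNat φ' n :=
  AddMonoidHom.toAddEquiv (KGroupNat.map η) (KGroupNat.comap η)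
    (KGroupNat.hom_ext fun σ => by
      obtain ⟨τ, h⟩ := KTriple.exists_corresponds_right η σ
      simp [KGroupNat.map_cls η h, KGroupNat.comap_cls η h])
    (KGroupNat.hom_ext fun τ => by
      obtain ⟨σ, h⟩ := KTriple.exists_corresponds_left η τ
      simp [KGroupNat.map_cls η h, KGroupNat.comap_cls η h])

end Equiv

end Square
end KInvariance

/-! ### Local frames of vector bundles -/

section Frames

set_option linter.unusedSectionVars false

variable {𝕜 : Type} [RCLike 𝕜] {Y : Type u} [TopologicalSpace Y]

/-- A linear local trivialization of a family of vector spaces, with model fibre `V`, given by mutually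
inverse families of linear maps. -/
structure LocalFrame (𝕜 : Type) [RCLike 𝕜] (V : Type) [NormedAddCommGroup V] [NormedSpace 𝕜 V]
    (E : Y → Type v) [∀ y, AddCommGroup (E y)] [∀ y, Module 𝕜 (E y)]
    [TopologicalSpace (TotalSpace PUnit.{1} E)] where
  /-- the open set on which the family is trivialized -/
  baseSet : Set Y
  isOpen_baseSet : IsOpen baseSet
  /-- the coordinates -/
  coord : ∀ y, E y →ₗ[𝕜] V
  /-- the vectors with given coordinates -/
  frame : ∀ y, V →ₗ[𝕜] E y
  coord_frame : ∀ y ∈ baseSet, ∀ v, coord y (frame y v) = v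
  frame_coord : ∀ y ∈ baseSet, ∀ x, frame y (coord y x) = x
  continuousOn_coord : ContinuousOn (fun z : TotalSpace PUnit.{1} E => coord z.proj z.snd)
    (TotalSpace.proj ⁻¹' baseSet)
  continuousOn_frame : ContinuousOn
    (fun p : Y × V => (⟨p.1, frame p.1 p.2⟩ : TotalSpace PUnit.{1} E)) (baseSet ×ˢ Set.univ)

namespace LocalFrame

variable {V : Type} [NormedAddCommGroup V] [NormedSpace 𝕜 V]
    {E : Y → Type v} [∀ y, AddCommGroup (E y)] [∀ y, Module 𝕜 (E y)]
    [TopologicalSpace (TotalSpace PUnit.{1} E)] (f : LocalFrame 𝕜 V E)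

/-- The trivialization given by a local frame and a basis of the model space. -/
def toTrivialization (hproj : Continuous (TotalSpace.proj : TotalSpace PUnit.{1} E → Y)) {n : ℕ}
    (c : V ≃L[𝕜] (Fin n → 𝕜)) :
    Trivialization (Fin n → 𝕜) (TotalSpace.proj : TotalSpace PUnit.{1} E → Y) where
  toFun z := (z.proj, c (f.coord z.proj z.snd))
  invFun p := ⟨p.1, f.frame p.1 (c.symm p.2)⟩
  source := TotalSpace.proj ⁻¹' f.baseSet
  target := f.baseSet ×ˢ Set.univ
  map_source' z hz := ⟨hz, trivial⟩
  map_target' p hp := hp.1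
  left_inv' := by
    rintro ⟨y, x⟩ hz
    have := f.frame_coord y hz x
    simp [this]
  right_inv' := by
    rintro ⟨y, x⟩ hz
    have := f.coord_frame y hz.1 (c.symm x)
    simp [this]
  open_source := f.isOpen_baseSet.preimage hproj
  open_target := f.isOpen_baseSet.prod isOpen_univ
  continuousOn_toFun := hproj.continuousOn.prodMk
    (c.continuous.comp_continuousOn f.continuousOn_coord)
  continuousOn_invFun := f.continuousOn_frame.comp
    (continuous_fst.prodMk (c.symm.continuous.comp continuous_snd)).continuousOn
    fun p hp => ⟨hp.1, trivial⟩
  baseSet := f.baseSet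
  open_baseSet := f.isOpen_baseSet
  source_eq := rfl
  target_eq := rfl
  proj_toFun _ _ := rfl

end LocalFrame

namespace VecBundle

/-- A vector bundle is given by a family of vector spaces which has local frames. -/
def ofFrames (E : Y → Type v) [∀ y, AddCommGroup (E y)] [∀ y, Module 𝕜 (E y)]
    [TopologicalSpace (TotalSpace PUnit.{1} E)]
    (hproj : Continuous (TotalSpace.proj : TotalSpace PUnit.{1} E → Y))
    (h : ∀ y, ∃ (V : Type) (_ : NormedAddCommGroup V) (_ : NormedSpace 𝕜 V)
      (_ : FiniteDimensional 𝕜 V) (f : LocalFrame 𝕜 V E), y ∈ f.baseSet) :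
    VecBundle.{u, v} 𝕜 Y where
  fiber := E
  locally_trivial y := by
    obtain ⟨V, _, _, _, f, hf⟩ := h y
    let c : V ≃L[𝕜] (Fin (Module.finrank 𝕜 V) → 𝕜) :=
      ContinuousLinearEquiv.ofFinrankEq (by simp)
    refine ⟨_, f.toTrivialization hproj c, hf, fun x _ => ?_⟩
    exact (c.toLinearMap ∘ₗ f.coord x).isLinear

variable (E F : VecBundle.{u, v} 𝕜 Y)

theorem exists_localFrame (y : Y) :
    ∃ (n : ℕ) (f : LocalFrame 𝕜 (Fin n → 𝕜) E.fiber), y ∈ f.baseSet := by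
  obtain ⟨n, e, hy, hlin⟩ := E.locally_trivial y
  have key : ∀ x : Y, ∃ (c : E.fiber x →ₗ[𝕜] (Fin n → 𝕜)) (s : (Fin n → 𝕜) →ₗ[𝕜] E.fiber x),
      x ∈ e.baseSet → (∀ v, c v = (e (TotalSpace.mk x v)).2) ∧ (∀ v, c (s v) = v) ∧
        ∀ v, s (c v) = v := by
    intro x
    by_cases hx : x ∈ e.baseSet
    · have hb : Function.Bijective (IsLinearMap.mk' _ (hlin x hx)) := by
        constructor
        · intro v w hvw
          have h1 : e (TotalSpace.mk x v) = e (TotalSpace.mk x w) := by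
            refine Prod.ext ?_ hvw
            rw [e.coe_fst (e.mem_source.2 hx), e.coe_fst (e.mem_source.2 hx)]
          have h2 := e.injOn (e.mem_source.2 hx) (e.mem_source.2 hx) h1
          simpa using h2
        · intro v
          have h1 : ((x, v) : Y × (Fin n → 𝕜)) ∈ e.target := e.mem_target.2 hx
          have h2 := e.apply_symm_apply h1
          have h3 := e.proj_symm_apply h1
          generalize e.toOpenPartialHomeomorph.symm (x, v) = z at h2 h3
          obtain ⟨x', w⟩ := z
          obtain rfl : x' = x := h3
          exact ⟨w, congrArg Prod.snd h2⟩
      let l := LinearEquiv.ofBijective _ hb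
      exact ⟨l, l.symm, fun _ => ⟨fun _ => rfl, fun v => l.apply_symm_apply v,
        fun v => l.symm_apply_apply v⟩⟩
    -- Outside the base set nothing is required; zero makes the coordinates and frames defined on
    -- all fibres.
    · exact ⟨0, 0, fun h => (hx h).elim⟩
  choose c s hcs using key
  refine ⟨n, ⟨e.baseSet, e.open_baseSet, c, s, fun x hx => (hcs x hx).2.1,
    fun x hx => (hcs x hx).2.2, ?_, ?_⟩, hy⟩
  · have h := continuous_snd.comp_continuousOn e.continuousOn_toFun
    rw [e.source_eq] at h
    exact h.congr fun z hz => (hcs z.proj hz).1 z.snd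
  · have h := e.toOpenPartialHomeomorph.continuousOn_symm
    change ContinuousOn _ e.target at h
    rw [e.target_eq] at h
    refine h.congr fun p hp => ?_
    -- The frame is the inverse chart, as both points have the same image under the injective chart;
    -- its continuity is then that of the inverse chart.
    refine e.injOn (e.mem_source.2 hp.1) (e.map_target (e.mem_target.2 hp.1)) ?_
    refine Eq.trans ?_ (e.apply_symm_apply (e.mem_target.2 hp.1)).symm
    refine Prod.ext (e.coe_fst (e.mem_source.2 hp.1)) ?_
    exact ((hcs p.1 hp.1).1 _).symm.trans ((hcs p.1 hp.1).2.1 _)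

/-! ### Continuity into a total space, tested in coordinates -/

section Continuity

variable {E F} {Z : Type*} [TopologicalSpace Z]

/-- Coordinates and frame are inverse and continuous over an open set that contains `b z` for z near
z₀. This reduces continuity of fibrewise operations to the normed space `V`. -/
theorem continuousAt_iff_coord {V : Type} [NormedAddCommGroup V] [NormedSpace 𝕜 V]
    (f : LocalFrame 𝕜 V E.fiber) {b : Z → Y} {x : ∀ z, E.fiber (b z)} {z₀ : Z}
    (hb : ContinuousAt b z₀) (hz : b z₀ ∈ f.baseSet) :
    ContinuousAt (fun z => (⟨b z, x z⟩ : E.Total)) z₀ ↔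
      ContinuousAt (fun z => f.coord (b z) (x z)) z₀ := by
  constructor
  · intro h
    have h1 : ContinuousAt (fun z : E.Total => f.coord z.proj z.snd) ⟨b z₀, x z₀⟩ :=
      f.continuousOn_coord.continuousAt
        ((f.isOpen_baseSet.preimage E.continuous_proj).mem_nhds hz)
    exact ContinuousAt.comp (f := fun z => (⟨b z, x z⟩ : E.Total)) h1 h
  · intro h
    have h1 := f.continuousOn_frame.continuousAt (x := (b z₀, f.coord (b z₀) (x z₀)))
      ((f.isOpen_baseSet.prod isOpen_univ).mem_nhds ⟨hz, trivial⟩)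
    have h2 := ContinuousAt.comp (f := fun z => (b z, f.coord (b z) (x z))) h1 (hb.prodMk h)
    refine h2.congr ?_
    filter_upwards [hb (f.isOpen_baseSet.mem_nhds hz)] with z hz'
    have := f.frame_coord (b z) hz' (x z)
    simp [this]

theorem continuousAt_base {b : Z → Y} {x : ∀ z, E.fiber (b z)} {z₀ : Z}
    (h : ContinuousAt (fun z => (⟨b z, x z⟩ : E.Total)) z₀) : ContinuousAt b z₀ :=
  ContinuousAt.comp (f := fun z => (⟨b z, x z⟩ : E.Total)) E.continuous_proj.continuousAt h

theorem continuousAt_add {b : Z → Y} {x x' : ∀ z, E.fiber (b z)} {z₀ : Z}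
    (h : ContinuousAt (fun z => (⟨b z, x z⟩ : E.Total)) z₀)
    (h' : ContinuousAt (fun z => (⟨b z, x' z⟩ : E.Total)) z₀) :
    ContinuousAt (fun z => (⟨b z, x z + x' z⟩ : E.Total)) z₀ := by
  obtain ⟨n, f, hf⟩ := E.exists_localFrame (b z₀)
  have hb := continuousAt_base h
  rw [continuousAt_iff_coord f hb hf] at h h' ⊢
  simp only [map_add]
  exact h.add h'

theorem continuousAt_smul {b : Z → Y} {c : Z → 𝕜} {x : ∀ z, E.fiber (b z)} {z₀ : Z}
    (hc : ContinuousAt c z₀) (h : ContinuousAt (fun z => (⟨b z, x z⟩ : E.Total)) z₀) :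
    ContinuousAt (fun z => (⟨b z, c z • x z⟩ : E.Total)) z₀ := by
  obtain ⟨n, f, hf⟩ := E.exists_localFrame (b z₀)
  have hb := continuousAt_base h
  rw [continuousAt_iff_coord f hb hf] at h ⊢
  simp only [map_smul]
  exact hc.smul h

theorem continuousAt_app (f : E ⟶ F) {b : Z → Y} {x : ∀ z, E.fiber (b z)} {z₀ : Z}
    (h : ContinuousAt (fun z => (⟨b z, x z⟩ : E.Total)) z₀) :
    ContinuousAt (fun z => (⟨b z, f.app (b z) (x z)⟩ : F.Total)) z₀ :=
  ContinuousAt.comp (f := fun z => (⟨b z, x z⟩ : E.Total)) f.continuous_totalMap.continuousAt h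

theorem continuous_add {b : Z → Y} {x x' : ∀ z, E.fiber (b z)}
    (h : Continuous (fun z => (⟨b z, x z⟩ : E.Total)))
    (h' : Continuous (fun z => (⟨b z, x' z⟩ : E.Total))) :
    Continuous (fun z => (⟨b z, x z + x' z⟩ : E.Total)) :=
  continuous_iff_continuousAt.2 fun _ => continuousAt_add h.continuousAt h'.continuousAt

theorem continuous_smul {b : Z → Y} {c : Z → 𝕜} {x : ∀ z, E.fiber (b z)}
    (hc : Continuous c) (h : Continuous (fun z => (⟨b z, x z⟩ : E.Total))) :
    Continuous (fun z => (⟨b z, c z • x z⟩ : E.Total)) :=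
  continuous_iff_continuousAt.2 fun _ => continuousAt_smul hc.continuousAt h.continuousAt

theorem continuous_neg {b : Z → Y} {x : ∀ z, E.fiber (b z)}
    (h : Continuous (fun z => (⟨b z, x z⟩ : E.Total))) :
    Continuous (fun z => (⟨b z, -x z⟩ : E.Total)) := by
  simpa using continuous_smul (c := fun _ => (-1 : 𝕜)) continuous_const h

end Continuity

/-! ### The topology on the spaces of morphisms -/

/-- A chart identifies a neighbourhood of each point with an open subset of Y × 𝕜ⁿ, from which
compact neighbourhoods are carried back. -/
instance [LocallyCompactSpace Y] : LocallyCompactSpace E.Total where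
  local_compact_nhds z s hs := by
    obtain ⟨n, e, hy, -⟩ := E.locally_trivial z.proj
    have hz : z ∈ e.source := e.mem_source.2 hy
    have h1 := e.toOpenPartialHomeomorph.symm.map_nhds_eq (e.map_source hz)
    have h2 := e.toOpenPartialHomeomorph.left_inv hz
    change Filter.map _ (𝓝 (e.toOpenPartialHomeomorph z)) = 𝓝 _ at h1
    rw [h2] at h1
    rw [← h1, Filter.mem_map] at hs
    have ht : e.target ∈ 𝓝 (e.toOpenPartialHomeomorph z) :=
      e.open_target.mem_nhds (e.map_source hz)
    obtain ⟨K, hK, hKs, hKc⟩ := local_compact_nhds (Filter.inter_mem hs ht)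
    refine ⟨e.toOpenPartialHomeomorph.symm '' K, ?_, ?_, ?_⟩
    · rw [← h1]
      exact Filter.image_mem_map hK
    · rintro _ ⟨k, hk, rfl⟩
      exact (hKs hk).1
    · exact hKc.image_of_continuousOn
        (e.toOpenPartialHomeomorph.continuousOn_symm.mono fun k hk => (hKs hk).2)

variable {E F}

/-- This is the exponential law for the compact-open topology; local compactness of the total space
of E makes evaluation continuous. Questions about the topology of morphism spaces become questions
of joint continuity. -/
theorem continuous_hom_iff [LocallyCompactSpace Y] {Z : Type*} [TopologicalSpace Z]
    {h : Z → (E ⟶ F)} :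
    Continuous h ↔ Continuous (fun p : Z × E.Total => totalMap (h p.1).app p.2) := by
  rw [continuous_induced_rng]
  constructor
  · intro hc
    exact (ContinuousEval.continuous_eval (F := C(E.Total, F.Total))).comp
      (hc.prodMap continuous_id)
  · intro hc
    exact ContinuousMap.continuous_of_continuous_uncurry _ hc

theorem continuous_toContinuousMap : Continuous
    (fun f : E ⟶ F => (⟨totalMap f.app, f.continuous_totalMap⟩ : C(E.Total, F.Total))) :=
  continuous_induced_dom

instance : SeparatelyContinuousComp (VecBundle.{u, v} 𝕜 Y) where
  continuous_comp_left f := continuous_induced_rng.2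
    ((ContinuousMap.continuous_precomp ⟨totalMap f.app, f.continuous_totalMap⟩).comp
      continuous_toContinuousMap)
  continuous_comp_right h := continuous_induced_rng.2
    ((ContinuousMap.continuous_postcomp ⟨totalMap h.app, h.continuous_totalMap⟩).comp
      continuous_toContinuousMap)

end VecBundle

end Frames

/-! ### The fixed bundle of an involution, and the sum of two bundles -/

section FixedBundle

set_option linter.unusedSectionVars false

variable {𝕜 : Type} [RCLike 𝕜] {Y : Type u} [TopologicalSpace Y]

/-- The projection on the fixed vectors of a linear involution. -/
def involutionProj {M : Type*} [AddCommGroup M] [Module 𝕜 M] (a : M →ₗ[𝕜] M)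
    (ha : ∀ x, a (a x) = x) : M →ₗ[𝕜] LinearMap.eqLocus a LinearMap.id :=
  LinearMap.codRestrict _ ((2⁻¹ : 𝕜) • (LinearMap.id + a)) fun x => by
    simp [LinearMap.mem_eqLocus, ha, add_comm]

theorem coe_involutionProj {M : Type*} [AddCommGroup M] [Module 𝕜 M] (a : M →ₗ[𝕜] M)
    (ha : ∀ x, a (a x) = x) (x : M) : (involutionProj a ha x : M) = (2⁻¹ : 𝕜) • (x + a x) := rfl

theorem involutionProj_of_fixed {M : Type*} [AddCommGroup M] [Module 𝕜 M] (a : M →ₗ[𝕜] M)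
    (ha : ∀ x, a (a x) = x) {x : M} (hx : a x = x) : (involutionProj a ha x : M) = x := by
  rw [coe_involutionProj, hx, ← two_smul 𝕜 x, smul_smul]
  simp

theorem continuousAt_ringInverse_comp {R Z : Type*} [NormedRing R] [HasSummableGeomSeries R]
    [TopologicalSpace Z] {a : Z → R} {z : Z} (ha : ContinuousAt a z) (hz : IsUnit (a z)) :
    ContinuousAt (fun z => Ring.inverse (a z)) z := by
  obtain ⟨s, hs⟩ := hz
  have h1 := NormedRing.inverse_continuousAt s
  rw [hs] at h1
  exact h1.comp ha

namespace VecBundle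

variable {E : VecBundle.{u, v} 𝕜 Y} (ε : E ⟶ E)

/-- The vectors fixed by an endomorphism of a vector bundle. -/
abbrev FixedFiber (y : Y) : Type v := LinearMap.eqLocus (ε.app y) LinearMap.id

/-- The topology on the fixed vectors is the one of a subspace. -/
instance : TopologicalSpace (TotalSpace PUnit.{1} (FixedFiber ε)) :=
  TopologicalSpace.induced (fun z => (⟨z.proj, z.snd.1⟩ : E.Total)) inferInstance

theorem continuousAt_fixed_iff {Z : Type*} [TopologicalSpace Z] {b : Z → Y}
    {x : ∀ z, FixedFiber ε (b z)} {z₀ : Z} :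
    ContinuousAt (fun z => (⟨b z, x z⟩ : TotalSpace PUnit.{1} (FixedFiber ε))) z₀ ↔
      ContinuousAt (fun z => (⟨b z, (x z).1⟩ : E.Total)) z₀ :=
  (Topology.IsInducing.mk rfl : Topology.IsInducing
    (fun z : TotalSpace PUnit.{1} (FixedFiber ε) => (⟨z.proj, z.snd.1⟩ : E.Total))).continuousAt_iff

theorem continuous_fixed_incl : Continuous
    (fun z : TotalSpace PUnit.{1} (FixedFiber ε) => (⟨z.proj, z.snd.1⟩ : E.Total)) :=
  continuous_induced_dom

variable {ε} (hε : ∀ y x, ε.app y (ε.app y x) = x)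

-- Let A y be the matrix of the involution in a frame and S y = 1 + A y₀ · A y. From A² = 1 follows
-- S y · A y = A y₀ · S y, so S y maps the fixed vectors of A y to those of A y₀. At y₀ it is
-- multiplication by 2, hence it is invertible nearby and trivializes the fixed bundle, with fibre
-- the fixed space at y₀.
include hε in
theorem exists_localFrame_fixed (y₀ : Y) : ∃ (V : Type) (_ : NormedAddCommGroup V)
    (_ : NormedSpace 𝕜 V) (_ : FiniteDimensional 𝕜 V) (f : LocalFrame 𝕜 V (FixedFiber ε)),
    y₀ ∈ f.baseSet := by
  obtain ⟨n, f, hf⟩ := E.exists_localFrame y₀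
  let A : Y → (Fin n → 𝕜) →L[𝕜] (Fin n → 𝕜) := fun y =>
    LinearMap.toContinuousLinearMap (f.coord y ∘ₗ ε.app y ∘ₗ f.frame y)
  have hA : ∀ y v, A y v = f.coord y (ε.app y (f.frame y v)) := fun _ _ => rfl
  have hAA : ∀ y ∈ f.baseSet, ∀ v, A y (A y v) = v := fun y hy v => by
    rw [hA, hA, f.frame_coord y hy, hε, f.coord_frame y hy]
  have hAc : ContinuousOn A f.baseSet := by
    rw [continuousOn_clm_apply]
    intro v y hy
    have h1 : ContinuousAt (fun y => (⟨y, f.frame y v⟩ : E.Total)) y := by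
      rw [continuousAt_iff_coord f (b := fun y => y) continuousAt_id hy]
      refine (continuousAt_const (y := v)).congr ?_
      filter_upwards [f.isOpen_baseSet.mem_nhds hy] with x hx
      exact (f.coord_frame x hx v).symm
    exact ((continuousAt_iff_coord f (b := fun y => y) continuousAt_id hy).1
      (continuousAt_app ε h1)).continuousWithinAt
  let S : Y → (Fin n → 𝕜) →L[𝕜] (Fin n → 𝕜) := fun y => 1 + A y₀ * A y
  have hS : ∀ y v, S y v = v + A y₀ (A y v) := fun _ _ => rfl
  have hSc : ContinuousOn S f.baseSet := continuousOn_const.add (continuousOn_const.mul hAc)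
  clear_value S
  clear_value A
  let U : Set Y := f.baseSet ∩ S ⁻¹' {s | IsUnit s}
  have hU : IsOpen U := hSc.isOpen_inter_preimage f.isOpen_baseSet Units.isOpen
  have hy₀ : y₀ ∈ U := by
    refine ⟨hf, ?_⟩
    have h2 : S y₀ = algebraMap 𝕜 ((Fin n → 𝕜) →L[𝕜] (Fin n → 𝕜)) 2 := by
      ext1 v
      rw [hS, hAA y₀ hf, Algebra.algebraMap_eq_smul_one]
      simp [two_smul]
    change IsUnit (S y₀)
    rw [h2]
    exact (IsUnit.mk0 (2 : 𝕜) two_ne_zero).map _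
  have hinv : ∀ y ∈ U, ∀ v, Ring.inverse (S y) (S y v) = v := fun y hy v =>
    DFunLike.congr_fun (Ring.inverse_mul_cancel _ hy.2) v
  have hinv' : ∀ y ∈ U, ∀ v, S y (Ring.inverse (S y) v) = v := fun y hy v =>
    DFunLike.congr_fun (Ring.mul_inverse_cancel _ hy.2) v
  have hSA : ∀ y ∈ U, ∀ v, S y (A y v) = A y₀ (S y v) := fun y hy v => by
    rw [hS, hS, hAA y hy.1, map_add, hAA y₀ hf, add_comm]
  have hIc : ∀ y ∈ U, ContinuousAt (fun y => Ring.inverse (S y)) y := fun y hy =>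
    continuousAt_ringInverse_comp (hSc.continuousAt (f.isOpen_baseSet.mem_nhds hy.1)) hy.2
  let W := LinearMap.eqLocus (A y₀).toLinearMap LinearMap.id
  -- Projecting to the fixed spaces makes coordinates and frames well defined at every y, also where
  -- S y fails to intertwine; over U the projections change nothing.
  let r : (Fin n → 𝕜) →ₗ[𝕜] W := involutionProj (A y₀).toLinearMap (hAA y₀ hf)
  have hr : ∀ v, A y₀ v = v → (r v : Fin n → 𝕜) = v := fun v hv =>
    involutionProj_of_fixed (A y₀).toLinearMap (hAA y₀ hf) hv
  refine ⟨W, inferInstance, inferInstance, inferInstance,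
    { baseSet := U
      isOpen_baseSet := hU
      coord := fun y => r ∘ₗ (S y).toLinearMap ∘ₗ f.coord y ∘ₗ Submodule.subtype _
      frame := fun y => involutionProj (ε.app y) (hε y) ∘ₗ f.frame y ∘ₗ
        (Ring.inverse (S y)).toLinearMap ∘ₗ Submodule.subtype _
      coord_frame := ?_
      frame_coord := ?_
      continuousOn_coord := ?_
      continuousOn_frame := ?_ }, hy₀⟩
  · rintro y hy ⟨w, hw⟩
    have hw' : A y₀ w = w := hw
    refine Subtype.ext ?_
    have h1 : f.coord y (involutionProj (ε.app y) (hε y) (f.frame y (Ring.inverse (S y) w))) =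
        (2⁻¹ : 𝕜) • (Ring.inverse (S y) w + A y (Ring.inverse (S y) w)) := by
      rw [coe_involutionProj, map_smul, map_add, f.coord_frame y hy.1, hA]
    have h2 : S y (f.coord y (involutionProj (ε.app y) (hε y)
        (f.frame y (Ring.inverse (S y) w)))) = w := by
      rw [h1, map_smul, map_add, hSA y hy, hinv' y hy, hw', ← two_smul 𝕜 w, smul_smul]
      simp
    change (r (S y (f.coord y (involutionProj (ε.app y) (hε y)
        (f.frame y (Ring.inverse (S y) w))))) : Fin n → 𝕜) = w
    rw [h2, hr w hw']
  · rintro y hy ⟨x, hx⟩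
    have hx' : ε.app y x = x := hx
    refine Subtype.ext ?_
    have h1 : A y (f.coord y x) = f.coord y x := by rw [hA, f.frame_coord y hy.1, hx']
    have h2 : A y₀ (S y (f.coord y x)) = S y (f.coord y x) := by rw [← hSA y hy, h1]
    change (involutionProj (ε.app y) (hε y) (f.frame y (Ring.inverse (S y)
      (r (S y (f.coord y x))))) : E.fiber y) = x
    rw [hr _ h2, hinv y hy, f.frame_coord y hy.1, involutionProj_of_fixed _ _ hx']
  · have h1 : ContinuousOn (fun z : TotalSpace PUnit.{1} (FixedFiber ε) =>
        f.coord z.proj z.snd.1) (TotalSpace.proj ⁻¹' U) :=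
      f.continuousOn_coord.comp (continuous_fixed_incl ε).continuousOn fun z hz => hz.1
    have h2 : ContinuousOn (fun z : TotalSpace PUnit.{1} (FixedFiber ε) => S z.proj)
        (TotalSpace.proj ⁻¹' U) :=
      hSc.comp (E.continuous_proj.comp (continuous_fixed_incl ε)).continuousOn fun z hz => hz.1
    exact r.toContinuousLinearMap.continuous.comp_continuousOn (h2.clm_apply h1)
  · rintro ⟨y, w⟩ hp
    have hy : y ∈ U := hp.1
    refine ContinuousAt.continuousWithinAt ((continuousAt_fixed_iff ε).2 ?_)
    have hSy : ContinuousAt (fun p : Y × W => Ring.inverse (S p.1)) (y, w) :=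
      ContinuousAt.comp (x := (y, w)) (f := fun p : Y × W => p.1)
        (g := fun y => Ring.inverse (S y)) (hIc y hy) continuousAt_fst
    have h2 : ContinuousAt (fun p : Y × W => Ring.inverse (S p.1) p.2.1) (y, w) :=
      hSy.clm_apply (continuous_subtype_val.comp continuous_snd).continuousAt
    have h3 : ContinuousAt (fun p : Y × W =>
        (⟨p.1, f.frame p.1 (Ring.inverse (S p.1) p.2.1)⟩ : E.Total)) (y, w) := by
      rw [continuousAt_iff_coord f continuousAt_fst hy.1]
      refine h2.congr ?_
      filter_upwards [continuousAt_fst (f.isOpen_baseSet.mem_nhds hy.1)] with p hp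
      exact (f.coord_frame p.1 hp _).symm
    exact continuousAt_smul continuousAt_const (continuousAt_add h3 (continuousAt_app ε h3))

/-- The bundle of vectors fixed by an involution. -/
def fixed (ε : E ⟶ E) (hε : ∀ y x, ε.app y (ε.app y x) = x) : VecBundle.{u, v} 𝕜 Y :=
  ofFrames (FixedFiber ε) (E.continuous_proj.comp (continuous_fixed_incl ε))
    (exists_localFrame_fixed hε)

theorem continuous_fixed_iff {Z : Type*} [TopologicalSpace Z] {b : Z → Y}
    {x : ∀ z, FixedFiber ε (b z)} :
    Continuous (fun z => (⟨b z, x z⟩ : (fixed ε hε).Total)) ↔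
      Continuous (fun z => (⟨b z, (x z).1⟩ : E.Total)) := by
  simp only [continuous_iff_continuousAt]
  exact forall_congr' fun z => continuousAt_fixed_iff ε

/-- The inclusion of the fixed bundle. -/
def fixedIncl : fixed ε hε ⟶ E where
  app _ := Submodule.subtype _
  continuous_totalMap := continuous_fixed_incl ε

/-- The projection on the fixed bundle. -/
def fixedProj : E ⟶ fixed ε hε where
  app y := involutionProj (ε.app y) (hε y)
  continuous_totalMap := (continuous_fixed_iff hε (b := fun z : E.Total => z.proj)
    (x := fun z => involutionProj (ε.app z.proj) (hε z.proj) z.snd)).2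
    (continuous_smul continuous_const
      (continuous_add (b := fun z : E.Total => z.proj) (x := fun z => z.snd) continuous_id
        ε.continuous_totalMap))

/-! ### Sums -/

variable (E) (F : VecBundle.{u, v} 𝕜 Y)

/-- The topology on the fibrewise product. -/
instance : TopologicalSpace (TotalSpace PUnit.{1} (fun y => E.fiber y × F.fiber y)) :=
  TopologicalSpace.induced
    (fun z => ((⟨z.proj, z.snd.1⟩, ⟨z.proj, z.snd.2⟩) : E.Total × F.Total)) inferInstance

theorem isInducing_prod : Topology.IsInducing
    (fun z : TotalSpace PUnit.{1} (fun y => E.fiber y × F.fiber y) =>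
      ((⟨z.proj, z.snd.1⟩, ⟨z.proj, z.snd.2⟩) : E.Total × F.Total)) :=
  Topology.IsInducing.mk rfl

theorem continuousAt_prod_iff {Z : Type*} [TopologicalSpace Z] {b : Z → Y}
    {x : ∀ z, E.fiber (b z)} {x' : ∀ z, F.fiber (b z)} {z₀ : Z} :
    ContinuousAt (fun z => (⟨b z, (x z, x' z)⟩ :
      TotalSpace PUnit.{1} (fun y => E.fiber y × F.fiber y))) z₀ ↔
      ContinuousAt (fun z => (⟨b z, x z⟩ : E.Total)) z₀ ∧
        ContinuousAt (fun z => (⟨b z, x' z⟩ : F.Total)) z₀ :=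
  (isInducing_prod E F).continuousAt_iff.trans
    ⟨fun h => ⟨continuousAt_fst.comp h, continuousAt_snd.comp h⟩, fun h => h.1.prodMk h.2⟩

theorem continuous_prod_fst : Continuous
    (fun z : TotalSpace PUnit.{1} (fun y => E.fiber y × F.fiber y) =>
      (⟨z.proj, z.snd.1⟩ : E.Total)) :=
  continuous_fst.comp (isInducing_prod E F).continuous

theorem continuous_prod_snd : Continuous
    (fun z : TotalSpace PUnit.{1} (fun y => E.fiber y × F.fiber y) =>
      (⟨z.proj, z.snd.2⟩ : F.Total)) :=
  continuous_snd.comp (isInducing_prod E F).continuous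

/-- The direct sum of two vector bundles. -/
def prod : VecBundle.{u, v} 𝕜 Y :=
  ofFrames (fun y => E.fiber y × F.fiber y) (E.continuous_proj.comp (continuous_prod_fst E F))
    (fun y => by
      obtain ⟨n, f, hf⟩ := E.exists_localFrame y
      obtain ⟨m, g, hg⟩ := F.exists_localFrame y
      refine ⟨(Fin n → 𝕜) × (Fin m → 𝕜), inferInstance, inferInstance, inferInstance,
        { baseSet := f.baseSet ∩ g.baseSet
          isOpen_baseSet := f.isOpen_baseSet.inter g.isOpen_baseSet
          coord := fun y => (f.coord y).prodMap (g.coord y)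
          frame := fun y => (f.frame y).prodMap (g.frame y)
          coord_frame := fun x hx _ => Prod.ext (f.coord_frame x hx.1 _) (g.coord_frame x hx.2 _)
          frame_coord := fun x hx _ => Prod.ext (f.frame_coord x hx.1 _) (g.frame_coord x hx.2 _)
          continuousOn_coord :=
            (f.continuousOn_coord.comp (continuous_prod_fst E F).continuousOn
              fun z hz => hz.1).prodMk
            (g.continuousOn_coord.comp (continuous_prod_snd E F).continuousOn fun z hz => hz.2)
          continuousOn_frame := ?_ }, ⟨hf, hg⟩⟩
      rintro ⟨y, v⟩ hp
      refine ContinuousAt.continuousWithinAt ((continuousAt_prod_iff E F).2 ⟨?_, ?_⟩)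
      · exact ContinuousAt.comp (f := fun p : Y × ((Fin n → 𝕜) × (Fin m → 𝕜)) => (p.1, p.2.1))
          (f.continuousOn_frame.continuousAt
            ((f.isOpen_baseSet.prod isOpen_univ).mem_nhds ⟨hp.1.1, trivial⟩))
          (by fun_prop)
      · exact ContinuousAt.comp (f := fun p : Y × ((Fin n → 𝕜) × (Fin m → 𝕜)) => (p.1, p.2.2))
          (g.continuousOn_frame.continuousAt
            ((g.isOpen_baseSet.prod isOpen_univ).mem_nhds ⟨hp.1.2, trivial⟩))
          (by fun_prop))

theorem continuous_prod_iff {Z : Type*} [TopologicalSpace Z] {b : Z → Y}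
    {x : ∀ z, E.fiber (b z)} {x' : ∀ z, F.fiber (b z)} :
    Continuous (fun z => (⟨b z, (x z, x' z)⟩ : (E.prod F).Total)) ↔
      Continuous (fun z => (⟨b z, x z⟩ : E.Total)) ∧
        Continuous (fun z => (⟨b z, x' z⟩ : F.Total)) := by
  simp only [continuous_iff_continuousAt, ← forall_and]
  exact forall_congr' fun z => continuousAt_prod_iff E F

end VecBundle

end FixedBundle

/-! ### Clifford module bundles by generators -/

namespace CliffordModuleBundle

set_option linter.unusedSectionVars false

variable {Y : Type u} [TopologicalSpace Y]
  {𝕜 : Type} [RCLike 𝕜] {F : Type*} {T : Y → Type w}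
  [∀ y, AddCommGroup (T y)] [∀ y, Module ℝ (T y)] [TopologicalSpace (TotalSpace F T)]
  {Q : ∀ y, QuadraticForm ℝ (T y)}

section Act

variable (M N : CliffordModuleBundle.{u, v, w} 𝕜 F Q)

/-- The action of the generators. -/
def act {y : Y} (t : T y) : Module.End 𝕜 (M.bundle.fiber y) :=
  M.action y (CliffordAlgebra.ι (Q y) t)

theorem act_add {y : Y} (s t : T y) : M.act (s + t) = M.act s + M.act t := by
  simp [act]

theorem act_smul {y : Y} (r : ℝ) (t : T y) (x : M.bundle.fiber y) :
    M.act (r • t) x = (r : 𝕜) • M.act t x := by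
  rw [act, map_smul, Algebra.smul_def, map_mul, Module.End.mul_apply, action_algebraMap, act]

theorem act_act_self {y : Y} (t : T y) (x : M.bundle.fiber y) :
    M.act t (M.act t x) = ((Q y t : ℝ) : 𝕜) • x := by
  rw [act, ← Module.End.mul_apply, ← map_mul, CliffordAlgebra.ι_sq_scalar, action_algebraMap]

theorem act_act_of_isOrtho {y : Y} {s t : T y} (h : (Q y).IsOrtho s t) (x : M.bundle.fiber y) :
    M.act s (M.act t x) = -M.act t (M.act s x) := by
  rw [act, act, ← Module.End.mul_apply, ← map_mul, CliffordAlgebra.ι_mul_ι_comm_of_isOrtho h,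
    map_neg, map_mul]
  rfl

theorem continuousAt_act {Z : Type*} [TopologicalSpace Z] {b : Z → Y} {t : ∀ z, T (b z)}
    {x : ∀ z, M.bundle.fiber (b z)} {z₀ : Z}
    (ht : ContinuousAt (fun z => (⟨b z, t z⟩ : TotalSpace F T)) z₀)
    (hx : ContinuousAt (fun z => (⟨b z, x z⟩ : M.bundle.Total)) z₀) :
    ContinuousAt (fun z => (⟨b z, M.act (t z) (x z)⟩ : M.bundle.Total)) z₀ := by
  have h : ContinuousAt (fun z => (⟨b z, (t z, x z)⟩ :
      TotalSpace (F × PUnit.{1}) (T ×ᵇ M.bundle.fiber))) z₀ :=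
    (FiberBundle.Prod.isInducing_diag F T PUnit.{1} M.bundle.fiber).continuousAt_iff.2
      (ht.prodMk hx)
  exact ContinuousAt.comp (f := fun z => (⟨b z, (t z, x z)⟩ :
      TotalSpace (F × PUnit.{1}) (T ×ᵇ M.bundle.fiber))) M.continuous_action.continuousAt h

theorem continuous_act {Z : Type*} [TopologicalSpace Z] {b : Z → Y} {t : ∀ z, T (b z)}
    {x : ∀ z, M.bundle.fiber (b z)}
    (ht : Continuous (fun z => (⟨b z, t z⟩ : TotalSpace F T)))
    (hx : Continuous (fun z => (⟨b z, x z⟩ : M.bundle.Total))) :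
    Continuous (fun z => (⟨b z, M.act (t z) (x z)⟩ : M.bundle.Total)) :=
  continuous_iff_continuousAt.2 fun _ => M.continuousAt_act ht.continuousAt hx.continuousAt

/-- A continuous section of `T` acts by a morphism of vector bundles. -/
def actHom (s : ∀ y, T y) (hs : Continuous (fun y => (⟨y, s y⟩ : TotalSpace F T))) :
    M.bundle ⟶ M.bundle where
  app y := M.act (s y)
  continuous_totalMap := M.continuous_act (b := fun z : M.bundle.Total => z.proj)
    (t := fun z => s z.proj) (x := fun z => z.snd) (hs.comp M.bundle.continuous_proj) continuous_id

variable {M N}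

/-- The vectors of T generate the Clifford algebra, and the elements with which f commutes form a
subalgebra. -/
theorem mem_homSubgroup_of_act {f : M.bundle ⟶ N.bundle}
    (h : ∀ y (t : T y) x, f.app y (M.act t x) = N.act t (f.app y x)) :
    f ∈ homSubgroup M N := by
  intro y a
  induction a using CliffordAlgebra.induction with
  | algebraMap r => intro x; rw [action_algebraMap, action_algebraMap, map_smul]
  | ι t => exact h y t
  | mul a b ha hb => intro x; rw [map_mul, map_mul, Module.End.mul_apply, ha, hb]; rfl
  | add a b ha hb => intro x; rw [map_add, map_add, LinearMap.add_apply, map_add, ha, hb]; rfl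

theorem app_act (f : M ⟶ N) {y : Y} (t : T y) (x : M.bundle.fiber y) :
    f.1.app y (M.act t x) = N.act t (f.1.app y x) := f.2 y _ x

/-- The morphism given by a morphism of vector bundles which commutes with the generators. -/
def homMk (f : M.bundle ⟶ N.bundle)
    (h : ∀ y (t : T y) x, f.app y (M.act t x) = N.act t (f.app y x)) : M ⟶ N :=
  ⟨f, mem_homSubgroup_of_act h⟩

theorem isInducing_val : Topology.IsInducing (fun f : M ⟶ N => (f.1 : M.bundle ⟶ N.bundle)) :=
  ⟨rfl⟩

instance : SeparatelyContinuousComp (CliffordModuleBundle.{u, v, w} 𝕜 F Q) where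
  continuous_comp_left f := isInducing_val.continuous_iff.2
    (SeparatelyContinuousComp.comp_left f.1 isInducing_val.continuous)
  continuous_comp_right h := isInducing_val.continuous_iff.2
    (SeparatelyContinuousComp.comp_right h.1 isInducing_val.continuous)

end Act

/-- The Clifford module bundle given by the action of the generators. -/
def ofGenerators (E : VecBundle.{u, v} 𝕜 Y) (σ : ∀ y, T y → Module.End 𝕜 (E.fiber y))
    (σ_add : ∀ y s t, σ y (s + t) = σ y s + σ y t)
    (σ_smul : ∀ y (r : ℝ) t, σ y (r • t) = (r : 𝕜) • σ y t)
    (σ_sq : ∀ y t x, σ y t (σ y t x) = ((Q y t : ℝ) : 𝕜) • x)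
    (σ_cont : Continuous (fun p : TotalSpace (F × PUnit.{1}) (T ×ᵇ E.fiber) =>
      (⟨p.proj, σ p.proj p.snd.1 p.snd.2⟩ : E.Total))) :
    CliffordModuleBundle.{u, v, w} 𝕜 F Q :=
  -- The universal property of the Clifford algebra needs a real algebra. Taking the structure
  -- through ℝ → 𝕜 makes `action_algebraMap` hold automatically.
  letI (y : Y) : Algebra ℝ (Module.End 𝕜 (E.fiber y)) :=
    Algebra.compHom _ (algebraMap ℝ 𝕜)
  let l (y : Y) : CliffordAlgebra (Q y) →ₐ[ℝ] Module.End 𝕜 (E.fiber y) :=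
    CliffordAlgebra.lift (Q y) ⟨{ toFun := σ y, map_add' := σ_add y, map_smul' := σ_smul y },
      fun t => LinearMap.ext fun x => σ_sq y t x⟩
  have hl (y : Y) (t : T y) : l y (CliffordAlgebra.ι (Q y) t) = σ y t :=
    CliffordAlgebra.lift_ι_apply _ _ _
  { bundle := E
    action := fun y => (l y).toRingHom
    action_algebraMap := fun y r v => DFunLike.congr_fun ((l y).commutes r) v
    continuous_action := by
      refine σ_cont.congr fun p => ?_
      rw [← hl]
      rfl }

theorem ofGenerators_act (E : VecBundle.{u, v} 𝕜 Y) (σ : ∀ y, T y → Module.End 𝕜 (E.fiber y))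
    (σ_add : ∀ y s t, σ y (s + t) = σ y s + σ y t)
    (σ_smul : ∀ y (r : ℝ) t, σ y (r • t) = (r : 𝕜) • σ y t)
    (σ_sq : ∀ y t x, σ y t (σ y t x) = ((Q y t : ℝ) : 𝕜) • x)
    (σ_cont : Continuous (fun p : TotalSpace (F × PUnit.{1}) (T ×ᵇ E.fiber) =>
      (⟨p.proj, σ p.proj p.snd.1 p.snd.2⟩ : E.Total))) {y : Y} (t : T y) :
    (ofGenerators (Q := Q) E σ σ_add σ_smul σ_sq σ_cont).act t = σ y t := by
  let : Algebra ℝ (Module.End 𝕜 (E.fiber y)) := Algebra.compHom _ (algebraMap ℝ 𝕜)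
  exact CliffordAlgebra.lift_ι_apply (Q := Q y) (A := Module.End 𝕜 (E.fiber y))
    { toFun := σ y, map_add' := σ_add y, map_smul' := σ_smul y }
    (fun t => LinearMap.ext fun x => σ_sq y t x) t

theorem restrict_act {F' : Type*} {T' : Y → Type w}
    [∀ y, AddCommGroup (T' y)] [∀ y, Module ℝ (T' y)] [TopologicalSpace (TotalSpace F' T')]
    {Q' : ∀ y, QuadraticForm ℝ (T' y)} (j : ∀ y, Q y →qᵢ Q' y)
    (hj : Continuous (fun t : TotalSpace F T => (⟨t.proj, j t.proj t.snd⟩ : TotalSpace F' T')))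
    (M : CliffordModuleBundle.{u, v, w} 𝕜 F' Q') {y : Y} (t : T y) :
    ((restrict 𝕜 j hj).obj M).act t = M.act (j y t) :=
  congrArg (M.action y) (CliffordAlgebra.map_apply_ι (j y) t)

end CliffordModuleBundle

/-! ### Continuous sections -/

section Sections

set_option linter.unusedSectionVars false

variable {Y : Type u} [TopologicalSpace Y] {F : Type*} [NormedAddCommGroup F] [NormedSpace ℝ F]
  {L : Y → Type w} [∀ y, AddCommGroup (L y)] [∀ y, Module ℝ (L y)]
  [∀ y, TopologicalSpace (L y)]
  [TopologicalSpace (TotalSpace F L)] [FiberBundle F L] [VectorBundle ℝ F L]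
  {Z : Type*} [TopologicalSpace Z]

variable (F L) in
theorem continuous_zero_section : Continuous (fun y => (⟨y, 0⟩ : TotalSpace F L)) := by
  rw [continuous_iff_continuousAt]
  intro y
  rw [FiberBundle.continuousAt_totalSpace]
  refine ⟨continuousAt_id, ?_⟩
  refine (continuousAt_const (y := (0 : F))).congr ?_
  filter_upwards [(trivializationAt F L y).open_baseSet.mem_nhds
    (FiberBundle.mem_baseSet_trivializationAt' y)] with x hx
  exact (congrArg Prod.snd ((trivializationAt F L y).zeroSection ℝ hx)).symm

theorem continuousAt_addTrivial {r : ℕ} {b : Z → Y} {t : ∀ z, L (b z)} {x : Z → Fin r → ℝ} {z₀ : Z}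
    (ht : ContinuousAt (fun z => (⟨b z, t z⟩ : TotalSpace F L)) z₀) (hx : ContinuousAt x z₀) :
    ContinuousAt (fun z => (⟨b z, (t z, x z)⟩ :
      TotalSpace (F × (Fin r → ℝ)) (addTrivial L r))) z₀ := by
  rw [(FiberBundle.Prod.isInducing_diag F L (Fin r → ℝ)
    (Bundle.Trivial Y (Fin r → ℝ))).continuousAt_iff]
  refine ht.prodMk ?_
  rw [(Bundle.Trivial.isInducing_toProd Y (Fin r → ℝ)).continuousAt_iff]
  exact ContinuousAt.prodMk (((FiberBundle.continuous_proj F L).continuousAt).comp ht) hx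

theorem continuous_addTrivial {r : ℕ} {b : Z → Y} {t : ∀ z, L (b z)} {x : Z → Fin r → ℝ}
    (ht : Continuous (fun z => (⟨b z, t z⟩ : TotalSpace F L))) (hx : Continuous x) :
    Continuous (fun z => (⟨b z, (t z, x z)⟩ : TotalSpace (F × (Fin r → ℝ)) (addTrivial L r))) :=
  continuous_iff_continuousAt.2 fun _ => continuousAt_addTrivial ht.continuousAt hx.continuousAt

theorem continuous_addTrivial_fst (r : ℕ) :
    Continuous (fun t : TotalSpace (F × (Fin r → ℝ)) (addTrivial L r) =>
      (⟨t.proj, t.snd.1⟩ : TotalSpace F L)) :=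
  continuous_fst.comp (FiberBundle.Prod.isInducing_diag F L (Fin r → ℝ)
    (Bundle.Trivial Y (Fin r → ℝ))).continuous

theorem continuous_addTrivial_snd (r : ℕ) :
    Continuous (fun t : TotalSpace (F × (Fin r → ℝ)) (addTrivial L r) =>
      (t.snd.2 : Fin r → ℝ)) :=
  (continuous_snd.comp (Bundle.Trivial.isInducing_toProd Y (Fin r → ℝ)).continuous).comp
    (continuous_snd.comp (FiberBundle.Prod.isInducing_diag F L (Fin r → ℝ)
      (Bundle.Trivial Y (Fin r → ℝ))).continuous)

theorem metricForm_ne_zero (g : ContinuousRiemannianMetric F L) {y : Y} {t : L y} (ht : t ≠ 0) :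
    metricForm g y t ≠ 0 := (g.pos y t ht).ne'

/-- Needed because the extension of morphisms divides by |t|². -/
theorem continuousAt_metricForm (g : ContinuousRiemannianMetric F L) {b : Z → Y}
    {t : ∀ z, L (b z)} {z₀ : Z}
    (ht : ContinuousAt (fun z => (⟨b z, t z⟩ : TotalSpace F L)) z₀) :
    ContinuousAt (fun z => metricForm g (b z) (t z)) z₀ := by
  have hb : ContinuousAt b z₀ := ((FiberBundle.continuous_proj F L).continuousAt).comp ht
  have h : ContinuousAt (fun z => TotalSpace.mk' ℝ (E := Bundle.Trivial Y ℝ) (b z)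
      (g.inner (b z) (t z) (t z))) z₀ :=
    ContinuousAt.clm_bundle_apply₂ (F₁ := F) (F₂ := F) (b := b)
      (g.continuous.continuousAt.comp hb) ht ht
  exact continuousAt_snd.comp ((Bundle.Trivial.isInducing_toProd Y ℝ).continuous.continuousAt.comp h)

end Sections

/-! ### Consequences of rank one -/

section LineBundle

variable {Y : Type u} [TopologicalSpace Y]
  {L : Y → Type w} [∀ y, AddCommGroup (L y)] [∀ y, Module ℝ (L y)]
  [∀ y, TopologicalSpace (L y)]
  [TopologicalSpace (TotalSpace ℝ L)] [FiberBundle ℝ L] [VectorBundle ℝ ℝ L]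

variable (L) in
/-- A line bundle has nonvanishing local sections. -/
theorem exists_local_section (y₀ : Y) : ∃ (U : Set Y) (s : ∀ y, L y), IsOpen U ∧ y₀ ∈ U ∧
    (∀ y ∈ U, s y ≠ 0) ∧ ContinuousOn (fun y => (⟨y, s y⟩ : TotalSpace ℝ L)) U := by
  let e := trivializationAt ℝ L y₀
  refine ⟨e.baseSet, fun y => e.symm y 1, e.open_baseSet,
    FiberBundle.mem_baseSet_trivializationAt' y₀, ?_, ?_⟩
  · intro y hy h
    have h1 := e.apply_mk_symm hy (1 : ℝ)
    change e.symm y 1 = 0 at h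
    rw [h] at h1
    have h2 := congrArg Prod.snd (e.zeroSection ℝ hy)
    have h3 : (e (⟨y, 0⟩ : TotalSpace ℝ L)).2 = 1 := congrArg Prod.snd h1
    exact zero_ne_one (h2.symm.trans h3)
  · exact (e.continuousOn_symm_prodMk_left (v := 1)).congr fun y hy => e.mk_symm hy 1

/-- Rank one enters the extension of morphisms here: the result is independent of the auxiliary
vector t, and commuting with t implies commuting with all of L. -/
theorem exists_eq_smul {y : Y} {t : L y} (ht : t ≠ 0) (s : L y) : ∃ c : ℝ, s = c • t := by
  let e := (trivializationAt ℝ L y).continuousLinearEquivAt ℝ y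
    (FiberBundle.mem_baseSet_trivializationAt' y)
  have h : e t ≠ 0 := by simpa using ht
  refine ⟨e s / e t, e.injective ?_⟩
  rw [map_smul, smul_eq_mul, div_mul_cancel₀ _ h]

end LineBundle

/-! ### The positive part of a module over `C⁺(L + 1)` -/

section FixedMap

variable {𝕜 : Type} [RCLike 𝕜] {Y : Type u} [TopologicalSpace Y]

/-- A morphism which commutes with involutions induces a morphism of the fixed bundles. -/
def VecBundle.fixedMap {E F : VecBundle.{u, v} 𝕜 Y} {ε : E ⟶ E} {δ : F ⟶ F}
    (hε : ∀ y x, ε.app y (ε.app y x) = x) (hδ : ∀ y x, δ.app y (δ.app y x) = x) (f : E ⟶ F)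
    (hf : ∀ y x, f.app y (ε.app y x) = δ.app y (f.app y x)) :
    VecBundle.fixed ε hε ⟶ VecBundle.fixed δ hδ where
  app y := (f.app y).restrict (p := LinearMap.eqLocus (ε.app y) LinearMap.id)
    (q := LinearMap.eqLocus (δ.app y) LinearMap.id) fun x hx => by
      have hx' : ε.app y x = x := hx
      have := hf y x
      rw [hx'] at this
      exact this.symm
  continuous_totalMap := (VecBundle.continuous_fixed_iff hδ
    (b := fun z : (VecBundle.fixed ε hε).Total => z.proj)).2
    (f.continuous_totalMap.comp (VecBundle.continuous_fixed_incl ε))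

end FixedMap

namespace CliffordModuleBundle

set_option linter.unusedSectionVars false

variable {𝕜 : Type} [RCLike 𝕜] {Y : Type u} [TopologicalSpace Y]
  {L : Y → Type w} [∀ y, AddCommGroup (L y)] [∀ y, Module ℝ (L y)]
  [∀ y, TopologicalSpace (L y)]
  [TopologicalSpace (TotalSpace ℝ L)] [FiberBundle ℝ L] [VectorBundle ℝ ℝ L]
  {g : ContinuousRiemannianMetric ℝ L}

theorem posForm_apply {r : ℕ} {y : Y} (t : addTrivial L r y) :
    posForm g r y t = metricForm g y t.1 + ∑ i, t.2 i * t.2 i := by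
  simp [posForm, QuadraticMap.weightedSumSquares_apply]

theorem negForm_apply {y : Y} (t : L y) : negForm g y t = -metricForm g y t := rfl

variable (L) in
/-- The unit vectors of the trivial summand of `L + r`. -/
def unitVec {r : ℕ} (i : Fin r) (y : Y) : addTrivial L r y := (0, (Pi.single i 1 : Fin r → ℝ))

variable (L) in
theorem continuous_unitVec {r : ℕ} (i : Fin r) : Continuous
    (fun y => (⟨y, unitVec L i y⟩ : TotalSpace (ℝ × (Fin r → ℝ)) (addTrivial L r))) :=
  continuous_addTrivial (continuous_zero_section ℝ L) continuous_const

section Operators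

variable {r : ℕ} (M : PosCliffordModules.{u, v, w} 𝕜 g r)

/-- The action of the unit vectors. -/
def actUnit (i : Fin r) (y : Y) : Module.End 𝕜 (M.bundle.fiber y) := M.act (unitVec L i y)

/-- The action of `L`. -/
def actLine {y : Y} (t : L y) : Module.End 𝕜 (M.bundle.fiber y) :=
  M.act ((t, 0) : addTrivial L r y)

theorem actUnit_actUnit_self (i : Fin r) (y : Y) (x : M.bundle.fiber y) :
    M.actUnit i y (M.actUnit i y x) = x := by
  have h : posForm g r y (unitVec L i y) = 1 := by
    rw [posForm_apply]
    simp [unitVec, Pi.single_apply]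
  rw [actUnit, act_act_self, h]
  simp

theorem actLine_actLine_self {y : Y} (t : L y) (x : M.bundle.fiber y) :
    M.actLine t (M.actLine t x) = ((metricForm g y t : ℝ) : 𝕜) • x := by
  have h : posForm g r y ((t, 0) : addTrivial L r y) = metricForm g y t := by
    rw [posForm_apply]
    simp
  rw [actLine, act_act_self, h]

theorem actLine_actUnit (i : Fin r) {y : Y} (t : L y) (x : M.bundle.fiber y) :
    M.actLine t (M.actUnit i y x) = -M.actUnit i y (M.actLine t x) := by
  refine M.act_act_of_isOrtho ?_ x
  rw [QuadraticMap.isOrtho_def, posForm_apply, posForm_apply, posForm_apply]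
  simp [unitVec]

theorem actUnit_actUnit {i j : Fin r} (hij : i ≠ j) (y : Y) (x : M.bundle.fiber y) :
    M.actUnit i y (M.actUnit j y x) = -M.actUnit j y (M.actUnit i y x) := by
  refine M.act_act_of_isOrtho ?_ x
  rw [QuadraticMap.isOrtho_def, posForm_apply, posForm_apply, posForm_apply]
  simp only [unitVec, Prod.fst_add, Prod.snd_add, add_zero, map_zero, zero_add,
    ← Finset.sum_add_distrib]
  refine Finset.sum_congr rfl fun k _ => ?_
  by_cases hk : k = i
  · subst hk
    simp [hij]
  · simp [Pi.single_apply, hk]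

theorem actLine_smul {y : Y} (c : ℝ) (t : L y) (x : M.bundle.fiber y) :
    M.actLine (c • t) x = (c : 𝕜) • M.actLine t x := by
  rw [actLine, actLine, ← act_smul]
  simp

theorem actLine_add {y : Y} (s t : L y) : M.actLine (s + t) = M.actLine s + M.actLine t := by
  rw [actLine, actLine, actLine, ← act_add]
  simp

/-- L and the unit vectors span L + r, so commutation with the action can be tested on them alone.
-/
theorem act_eq_sum {y : Y} (t : addTrivial L r y) (x : M.bundle.fiber y) :
    M.act t x = M.actLine t.1 x + ∑ i, ((t.2 i : ℝ) : 𝕜) • M.actUnit i y x := by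
  have h : t = ((t.1, 0) : addTrivial L r y) + ∑ i, t.2 i • unitVec L i y := by
    refine Prod.ext ?_ ?_
    · simp [unitVec, Prod.fst_sum]
    · ext j
      simp [unitVec, Prod.snd_sum, Pi.single_apply]
  have h2 : ∀ s : Finset (Fin r), M.act (∑ i ∈ s, t.2 i • unitVec L i y) x =
      ∑ i ∈ s, ((t.2 i : ℝ) : 𝕜) • M.actUnit i y x := by
    intro s
    induction s using Finset.cons_induction with
    | empty => simp [act]
    | cons i s hi ih => rw [Finset.sum_cons, Finset.sum_cons, act_add, LinearMap.add_apply, ih,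
        act_smul, actUnit]
  conv_lhs => rw [h]
  rw [act_add, LinearMap.add_apply, h2, actLine]

theorem continuousAt_actLine {Z : Type*} [TopologicalSpace Z] {b : Z → Y} {t : ∀ z, L (b z)}
    {x : ∀ z, M.bundle.fiber (b z)} {z₀ : Z}
    (ht : ContinuousAt (fun z => (⟨b z, t z⟩ : TotalSpace ℝ L)) z₀)
    (hx : ContinuousAt (fun z => (⟨b z, x z⟩ : M.bundle.Total)) z₀) :
    ContinuousAt (fun z => (⟨b z, M.actLine (t z) (x z)⟩ : M.bundle.Total)) z₀ :=
  M.continuousAt_act (continuousAt_addTrivial ht continuousAt_const) hx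

variable {M} {N : PosCliffordModules.{u, v, w} 𝕜 g r}

/-- Morphisms are the morphisms of vector bundles which commute with `L` and the unit vectors. -/
def homMkOfUnits (f : M.bundle ⟶ N.bundle)
    (hL : ∀ y (t : L y) x, f.app y (M.actLine t x) = N.actLine t (f.app y x))
    (hU : ∀ i y x, f.app y (M.actUnit i y x) = N.actUnit i y (f.app y x)) : M ⟶ N :=
  homMk f fun y t x => by simp only [act_eq_sum, map_add, map_sum, map_smul, hL, hU]

theorem app_actLine (f : M ⟶ N) {y : Y} (t : L y) (x : M.bundle.fiber y) :
    f.1.app y (M.actLine t x) = N.actLine t (f.1.app y x) := app_act f _ x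

theorem app_actUnit (f : M ⟶ N) (i : Fin r) (y : Y) (x : M.bundle.fiber y) :
    f.1.app y (M.actUnit i y x) = N.actUnit i y (f.1.app y x) := app_act f _ x

end Operators

/-! ### Full faithfulness of the positive part, with topologies -/

section PositivePart

/-- The involution given by the first unit vector. -/
def involution (M : PosCliffordModules.{u, v, w} 𝕜 g 1) : M.bundle ⟶ M.bundle :=
  M.actHom (unitVec L 0) (continuous_unitVec L 0)

theorem involution_involution (M : PosCliffordModules.{u, v, w} 𝕜 g 1) (y : Y)
    (x : M.bundle.fiber y) : (involution M).app y ((involution M).app y x) = x :=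
  M.actUnit_actUnit_self 0 y x

variable (𝕜 g) in
/-- The functor of positive parts, from `C⁺(L + 1)`-module bundles to vector bundles. -/
def positivePart : PosCliffordModules.{u, v, w} 𝕜 g 1 ⥤ VecBundle.{u, v} 𝕜 Y where
  obj M := VecBundle.fixed (involution M) (involution_involution M)
  map {M N} f := VecBundle.fixedMap (involution_involution M) (involution_involution N) f.1
    (app_actUnit f 0)

instance : (positivePart.{u, v, w} 𝕜 g).Additive where
  map_add := rfl

variable {M N : PosCliffordModules.{u, v, w} 𝕜 g 1}

/-- A morphism of positive parts, extended by zero to the negative part. -/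
def extendByZero (h : (positivePart 𝕜 g).obj M ⟶ (positivePart 𝕜 g).obj N) :
    M.bundle ⟶ N.bundle :=
  VecBundle.fixedProj (involution_involution M) ≫ h ≫
    VecBundle.fixedIncl (involution_involution N)

variable (h : (positivePart 𝕜 g).obj M ⟶ (positivePart 𝕜 g).obj N)

theorem extendByZero_app {y : Y} {x : M.bundle.fiber y} (hx : M.actUnit 0 y x = x) :
    (extendByZero h).app y x = (h.app y ⟨x, hx⟩).1 := by
  refine congrArg (fun z : VecBundle.FixedFiber (involution M) y =>
    (h.app y z : VecBundle.FixedFiber (involution N) y).1) ?_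
  exact Subtype.ext (involutionProj_of_fixed _ (involution_involution M y) hx)

/-- The projection ½(1 + e₁) absorbs e₁. -/
theorem extendByZero_actUnit (y : Y) (x : M.bundle.fiber y) :
    (extendByZero h).app y (M.actUnit 0 y x) = (extendByZero h).app y x := by
  refine congrArg (fun z : VecBundle.FixedFiber (involution M) y =>
    (h.app y z : VecBundle.FixedFiber (involution N) y).1) ?_
  refine Subtype.ext ?_
  change (2⁻¹ : 𝕜) • (M.actUnit 0 y x + M.actUnit 0 y (M.actUnit 0 y x)) =
    (2⁻¹ : 𝕜) • (x + M.actUnit 0 y x)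
  rw [actUnit_actUnit_self, add_comm]

theorem actUnit_extendByZero (y : Y) (x : M.bundle.fiber y) :
    N.actUnit 0 y ((extendByZero h).app y x) = (extendByZero h).app y x :=
  (h.app y (involutionProj _ (involution_involution M y) x) :
    VecBundle.FixedFiber (involution N) y).2

/-- As t anticommutes with e₁, it sends positive vectors to negative ones, where the extension by
zero vanishes. -/
theorem extendByZero_actLine {y : Y} (t : L y) {x : M.bundle.fiber y} (hx : M.actUnit 0 y x = x) :
    (extendByZero h).app y (M.actLine t x) = 0 := by
  have h1 := extendByZero_actUnit h y (M.actLine t x)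
  have h2 := M.actLine_actUnit 0 t x
  rw [hx] at h2
  rw [← neg_eq_iff_eq_neg] at h2
  rw [← h2, map_neg, neg_eq_iff_add_eq_zero, ← two_smul 𝕜] at h1
  exact (smul_eq_zero.1 h1).resolve_left two_ne_zero

/-- The extension of a morphism of positive parts to the whole module, by means of a vector of `L`. -/
def extendAt (y : Y) (t : L y) : M.bundle.fiber y →ₗ[𝕜] N.bundle.fiber y :=
  (extendByZero h).app y + ((metricForm g y t : ℝ) : 𝕜)⁻¹ •
    (N.actLine t ∘ₗ (extendByZero h).app y ∘ₗ M.actLine t)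

theorem extendAt_apply (y : Y) (t : L y) (x : M.bundle.fiber y) :
    extendAt h y t x = (extendByZero h).app y x + ((metricForm g y t : ℝ) : 𝕜)⁻¹ •
      N.actLine t ((extendByZero h).app y (M.actLine t x)) := rfl

theorem metricForm_cast_ne_zero {y : Y} {t : L y} (ht : t ≠ 0) :
    ((metricForm g y t : ℝ) : 𝕜) ≠ 0 :=
  RCLike.ofReal_ne_zero.2 (metricForm_ne_zero g ht)

/-- The second summand is homogeneous of degree zero in t: the factor c² from the two actions of t
cancels that of |t|². -/
theorem extendAt_eq {y : Y} {t t' : L y} (ht : t ≠ 0) (ht' : t' ≠ 0) :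
    extendAt h y t' = extendAt h y t := by
  obtain ⟨c, rfl⟩ := exists_eq_smul ht t'
  have hc : (c : 𝕜) ≠ 0 := RCLike.ofReal_ne_zero.2 fun hc => ht' (by rw [hc, zero_smul])
  have hQ := metricForm_cast_ne_zero (g := g) (𝕜 := 𝕜) ht
  ext x
  rw [extendAt_apply, extendAt_apply, actLine_smul, actLine_smul, QuadraticMap.map_smul, map_smul,
    map_smul, smul_smul, smul_smul]
  congr 2
  rw [smul_eq_mul]
  push_cast
  field_simp

/-- The first summand ĥ absorbs e₁ on both sides. In t ĥ t, moving e₁ past either t costs a sign, so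
both sides yield the same -t ĥ t. -/
theorem extendAt_actUnit (y : Y) (t : L y) (x : M.bundle.fiber y) :
    extendAt h y t (M.actUnit 0 y x) = N.actUnit 0 y (extendAt h y t x) := by
  rw [extendAt_apply, extendAt_apply, extendByZero_actUnit, actLine_actUnit, map_neg,
    extendByZero_actUnit, map_neg, map_add, map_smul, actUnit_extendByZero]
  congr 2
  have h1 := N.actLine_actUnit 0 t ((extendByZero h).app y (M.actLine t x))
  rw [actUnit_extendByZero] at h1
  exact neg_eq_iff_eq_neg.2 h1

/-- Since t² = |t|², composing with t on either side gives ĥ t + t ĥ; the two summands are merely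
interchanged. -/
theorem extendAt_actLine {y : Y} {t : L y} (ht : t ≠ 0) (s : L y) (x : M.bundle.fiber y) :
    extendAt h y t (M.actLine s x) = N.actLine s (extendAt h y t x) := by
  obtain ⟨c, rfl⟩ := exists_eq_smul ht s
  have hQ := metricForm_cast_ne_zero (g := g) (𝕜 := 𝕜) ht
  rw [actLine_smul, actLine_smul, map_smul]
  congr 1
  rw [extendAt_apply, extendAt_apply, actLine_actLine_self, map_smul, map_smul, smul_smul,
    inv_mul_cancel₀ hQ, one_smul, map_add, map_smul, actLine_actLine_self, smul_smul,
    inv_mul_cancel₀ hQ, one_smul, add_comm]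

theorem extendAt_of_fixed (y : Y) (t : L y) {x : M.bundle.fiber y} (hx : M.actUnit 0 y x = x) :
    extendAt h y t x = (h.app y ⟨x, hx⟩).1 := by
  rw [extendAt_apply, extendByZero_actLine h t hx, extendByZero_app h hx, map_zero, smul_zero,
    add_zero]

variable (L) in
theorem exists_ne_zero (y : Y) : ∃ t : L y, t ≠ 0 := by
  obtain ⟨U, s, -, hy, hs, -⟩ := exists_local_section L y
  exact ⟨s y, hs y hy⟩

/-- The choice y ↦ t y is not assumed continuous: near each point it may be replaced by a continuous
nonvanishing local section, by `extendAt_eq`. The parameter space Z serves both for a single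
extension (Z a point) and for continuous dependence on h. -/
theorem continuous_extendAt [LocallyCompactSpace Y] {Z : Type*} [TopologicalSpace Z]
    {H : Z → ((positivePart 𝕜 g).obj M ⟶ (positivePart 𝕜 g).obj N)} (hH : Continuous H)
    {t : ∀ y, L y} (ht : ∀ y, t y ≠ 0) :
    Continuous (fun p : Z × M.bundle.Total =>
      (⟨p.2.proj, extendAt (H p.1) p.2.proj (t p.2.proj) p.2.snd⟩ : N.bundle.Total)) := by
  have hk : Continuous (fun z => extendByZero (H z)) :=
    SeparatelyContinuousComp.comp_left _ (SeparatelyContinuousComp.comp_right _ hH)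
  rw [VecBundle.continuous_hom_iff] at hk
  have hb : Continuous (fun p : Z × M.bundle.Total => p.2.proj) :=
    M.bundle.continuous_proj.comp continuous_snd
  rw [continuous_iff_continuousAt]
  intro p₀
  obtain ⟨U, s, hU, hy, hs, hsc⟩ := exists_local_section L p₀.2.proj
  have hs' : ContinuousAt (fun p : Z × M.bundle.Total =>
      (⟨p.2.proj, s p.2.proj⟩ : TotalSpace ℝ L)) p₀ :=
    ContinuousAt.comp (x := p₀) (f := fun p : Z × M.bundle.Total => p.2.proj)
      (g := fun y => (⟨y, s y⟩ : TotalSpace ℝ L))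
      (hsc.continuousAt (hU.mem_nhds hy)) hb.continuousAt
  have h1 : ContinuousAt (fun p : Z × M.bundle.Total =>
      (⟨p.2.proj, M.actLine (s p.2.proj) p.2.snd⟩ : M.bundle.Total)) p₀ :=
    M.continuousAt_actLine (b := fun p : Z × M.bundle.Total => p.2.proj) hs'
      continuous_snd.continuousAt
  have h2 : ContinuousAt (fun p : Z × M.bundle.Total => (⟨p.2.proj,
      (extendByZero (H p.1)).app p.2.proj (M.actLine (s p.2.proj) p.2.snd)⟩ : N.bundle.Total)) p₀ :=
    ContinuousAt.comp (f := fun p : Z × M.bundle.Total =>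
      (p.1, (⟨p.2.proj, M.actLine (s p.2.proj) p.2.snd⟩ : M.bundle.Total)))
      hk.continuousAt (continuousAt_fst.prodMk h1)
  have hQ : ContinuousAt (fun p : Z × M.bundle.Total =>
      ((metricForm g p.2.proj (s p.2.proj) : ℝ) : 𝕜)⁻¹) p₀ :=
    ContinuousAt.inv₀ (RCLike.continuous_ofReal.continuousAt.comp (continuousAt_metricForm g hs'))
      (metricForm_cast_ne_zero (hs _ hy))
  have h3 := VecBundle.continuousAt_add (hk.continuousAt (x := p₀))
    (VecBundle.continuousAt_smul hQ (N.continuousAt_actLine hs' h2))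
  refine h3.congr ?_
  filter_upwards [hb.continuousAt (hU.mem_nhds hy)] with p hp
  have := DFunLike.congr_fun (extendAt_eq (H p.1) (ht p.2.proj) (hs _ hp)) p.2.snd
  exact congrArg (fun x => (⟨p.2.proj, x⟩ : N.bundle.Total)) this

/-- The extension of a morphism of positive parts to the whole modules. -/
def extend [LocallyCompactSpace Y] : M ⟶ N :=
  homMkOfUnits
    { app := fun y => extendAt h y (exists_ne_zero L y).choose
      continuous_totalMap :=
        (continuous_extendAt (continuous_const (X := Unit) (y := h))
          fun y => (exists_ne_zero L y).choose_spec).comp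
          (continuous_const (y := ()).prodMk continuous_id) }
    (fun y t x => extendAt_actLine h (exists_ne_zero L y).choose_spec t x)
    (fun i y x => by
      obtain rfl : i = 0 := Subsingleton.elim _ _
      exact extendAt_actUnit h y _ x)

theorem continuous_extend [LocallyCompactSpace Y] : Continuous
    (fun h : (positivePart 𝕜 g).obj M ⟶ (positivePart 𝕜 g).obj N => (extend h : M ⟶ N)) := by
  rw [isInducing_val.continuous_iff, VecBundle.continuous_hom_iff]
  exact continuous_extendAt (H := fun h : (positivePart 𝕜 g).obj M ⟶ (positivePart 𝕜 g).obj N => h)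
    continuous_id (t := fun y => (exists_ne_zero L y).choose)
    fun y => (exists_ne_zero L y).choose_spec

theorem positivePart_map_extend [LocallyCompactSpace Y] :
    (positivePart 𝕜 g).map (extend h) = h := by
  ext y x
  exact Subtype.ext (extendAt_of_fixed h y _ x.2)

/-- A module morphism is determined by its positive part: on a negative x it is recovered from its
value on the positive vector t x, because t² = |t|² ≠ 0. -/
theorem positivePart_map_injective :
    Function.Injective (fun f : M ⟶ N => (positivePart 𝕜 g).map f) := by
  intro f f' hff
  have h1 : ∀ y (x : M.bundle.fiber y), M.actUnit 0 y x = x → f.1.app y x = f'.1.app y x :=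
    fun y x hx => congrArg (fun k : (positivePart 𝕜 g).obj M ⟶ (positivePart 𝕜 g).obj N =>
      (k.app y ⟨x, hx⟩ : VecBundle.FixedFiber (involution N) y).1) hff
  have h2 : ∀ y (x : M.bundle.fiber y), M.actUnit 0 y x = -x → f.1.app y x = f'.1.app y x := by
    intro y x hx
    obtain ⟨t, ht⟩ := exists_ne_zero L y
    have hQ := metricForm_cast_ne_zero (g := g) (𝕜 := 𝕜) ht
    have h3 := h1 y (M.actLine t x) (by
      rw [← neg_inj, ← actLine_actUnit, hx, map_neg])
    rw [app_actLine, app_actLine] at h3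
    have h4 := congrArg (N.actLine t) h3
    rw [actLine_actLine_self, actLine_actLine_self] at h4
    exact smul_right_injective _ hQ h4
  refine Subtype.ext (VecBundle.hom_ext fun y => LinearMap.ext fun x => ?_)
  have h3 : x = (2⁻¹ : 𝕜) • (x + M.actUnit 0 y x) + (2⁻¹ : 𝕜) • (x - M.actUnit 0 y x) := by
    rw [← smul_add, add_add_sub_cancel, ← two_smul 𝕜 x, smul_smul, inv_mul_cancel₀ two_ne_zero,
      one_smul]
  rw [h3, map_add, map_add, h1, h2]
  · rw [map_smul, map_sub, actUnit_actUnit_self, ← smul_neg, neg_sub]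
  · rw [map_smul, map_add, actUnit_actUnit_self, add_comm]

instance [LocallyCompactSpace Y] : IsHomHomeomorph (positivePart.{u, v, w} 𝕜 g) where
  isHomeomorph M N := by
    let e : (M ⟶ N) ≃ₜ ((positivePart 𝕜 g).obj M ⟶ (positivePart 𝕜 g).obj N) :=
      { toFun := (positivePart 𝕜 g).map
        invFun := fun h => extend h
        -- An injective map with a right inverse is bijective, so uniqueness of the extension needs
        -- no further computation.
        left_inv := fun f => positivePart_map_injective (positivePart_map_extend _)
        right_inv := fun h => positivePart_map_extend h
        continuous_toFun := by
          have h1 := VecBundle.continuous_hom_iff.1 (isInducing_val (M := M) (N := N)).continuous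
          refine VecBundle.continuous_hom_iff.2 ?_
          refine (VecBundle.continuous_fixed_iff (involution_involution N)
            (b := fun p : (M ⟶ N) × ((positivePart 𝕜 g).obj M).Total => p.2.proj)).2 ?_
          exact h1.comp (continuous_id.prodMap (VecBundle.continuous_fixed_incl (involution M)))
        continuous_invFun := continuous_extend }
    exact e.isHomeomorph

end PositivePart

end CliffordModuleBundle

/-! ### Modules over `C⁺(L + 2)` and over `C⁻(L)` -/

namespace CliffordModuleBundle

set_option linter.unusedSectionVars false

variable {𝕜 : Type} [RCLike 𝕜] {Y : Type u} [TopologicalSpace Y]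
  {L : Y → Type w} [∀ y, AddCommGroup (L y)] [∀ y, Module ℝ (L y)]
  [∀ y, TopologicalSpace (L y)]
  [TopologicalSpace (TotalSpace ℝ L)] [FiberBundle ℝ L] [VectorBundle ℝ ℝ L]
  {g : ContinuousRiemannianMetric ℝ L}

/-! ### The action of C⁻(L) on the positive part -/

section ExtraUnit

/-- An involution of a `C⁺(L + 1)`-module bundle which anticommutes with `L` and the unit vector. -/
structure ExtraUnit (P : PosCliffordModules.{u, v, w} 𝕜 g 1) where
  /-- the involution -/
  hom : P.bundle ⟶ P.bundle
  hom_hom (y : Y) (x : P.bundle.fiber y) : hom.app y (hom.app y x) = x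
  actLine_hom {y : Y} (t : L y) (x : P.bundle.fiber y) :
    P.actLine t (hom.app y x) = -hom.app y (P.actLine t x)
  actUnit_hom (y : Y) (x : P.bundle.fiber y) :
    P.actUnit 0 y (hom.app y x) = -hom.app y (P.actUnit 0 y x)

variable {P P' : PosCliffordModules.{u, v, w} 𝕜 g 1}

namespace ExtraUnit

variable (ω : ExtraUnit P) (ω' : ExtraUnit P')

/-- Both t and the extra unit anticommute with e₁, so their product commutes with it and preserves
the positive part. -/
theorem actUnit_rotate {y : Y} (t : L y) {x : P.bundle.fiber y} (hx : P.actUnit 0 y x = x) :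
    P.actUnit 0 y (-P.actLine t (ω.hom.app y x)) = -P.actLine t (ω.hom.app y x) := by
  rw [map_neg, ← P.actLine_actUnit, ω.actUnit_hom, hx, map_neg]

/-- t e₂ t e₂ = -t² e₂² = -|t|²: this sign turns the positive form into the negative one. -/
theorem rotate_rotate {y : Y} (t : L y) (x : P.bundle.fiber y) :
    -P.actLine t (ω.hom.app y (-P.actLine t (ω.hom.app y x))) =
      ((negForm g y t : ℝ) : 𝕜) • x := by
  rw [map_neg, map_neg, neg_neg, ← neg_eq_iff_eq_neg.2 (ω.actLine_hom t (ω.hom.app y x)),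
    ω.hom_hom, map_neg, actLine_actLine_self, negForm_apply, RCLike.ofReal_neg, neg_smul]

/-- For unit vectors `e₁` and `e₂`, the action of `t ∈ L` by `t e₁ e₂` on the vectors fixed by
`e₁`. -/
def rotate {y : Y} (t : L y) : Module.End 𝕜 (VecBundle.FixedFiber (involution P) y) :=
  LinearMap.restrict (-(P.actLine t ∘ₗ ω.hom.app y)) fun _ hx => ω.actUnit_rotate t hx

theorem coe_rotate {y : Y} (t : L y) (x : VecBundle.FixedFiber (involution P) y) :
    (ω.rotate t x).1 = -P.actLine t (ω.hom.app y x.1) := rfl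

theorem rotate_add {y : Y} (s t : L y) : ω.rotate (s + t) = ω.rotate s + ω.rotate t := by
  refine LinearMap.ext fun x => Subtype.ext ?_
  rw [LinearMap.add_apply, Submodule.coe_add, coe_rotate, coe_rotate, coe_rotate, actLine_add,
    LinearMap.add_apply, neg_add]

theorem rotate_smul {y : Y} (c : ℝ) (t : L y) : ω.rotate (c • t) = (c : 𝕜) • ω.rotate t := by
  refine LinearMap.ext fun x => Subtype.ext ?_
  rw [LinearMap.smul_apply, Submodule.coe_smul, coe_rotate, coe_rotate, actLine_smul, smul_neg]

/-- The positive part of a `C⁺(L + 1)`-module bundle with an additional unit, as a `C⁻(L)`-module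
bundle. -/
def negPart : NegCliffordModules.{u, v, w} 𝕜 g :=
  ofGenerators ((positivePart 𝕜 g).obj P) (fun _ t => ω.rotate t)
    (fun _ s t => ω.rotate_add s t) (fun _ c t => ω.rotate_smul c t)
    (fun _ t x => Subtype.ext (ω.rotate_rotate t x.1))
    (by
      have hind := FiberBundle.Prod.isInducing_diag ℝ L PUnit.{1} ((positivePart 𝕜 g).obj P).fiber
      refine (VecBundle.continuous_fixed_iff (involution_involution P)).2 ?_
      refine VecBundle.continuous_neg (continuous_iff_continuousAt.2 fun p => ?_)
      refine P.continuousAt_actLine (continuous_fst.comp hind.continuous).continuousAt ?_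
      exact (ω.hom.continuous_totalMap.comp ((VecBundle.continuous_fixed_incl (involution P)).comp
        (continuous_snd.comp hind.continuous))).continuousAt)

theorem negPart_act {y : Y} (t : L y) : ω.negPart.act t = ω.rotate t :=
  ofGenerators_act _ _ _ _ _ _ t

variable {ω ω'}

/-- A morphism which commutes with the additional units induces a morphism of `C⁻(L)`-module
bundles. -/
def negPartMap (f : P ⟶ P') (hf : ∀ y x, f.1.app y (ω.hom.app y x) = ω'.hom.app y (f.1.app y x)) :
    ω.negPart ⟶ ω'.negPart :=
  homMk ((positivePart 𝕜 g).map f) fun y t x => by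
    have h : ∀ x : P.bundle.fiber y, f.1.app y (-P.actLine t (ω.hom.app y x)) =
        -P'.actLine t (ω'.hom.app y (f.1.app y x)) := fun x => by
      rw [map_neg, app_actLine, hf]
    rw [negPart_act, negPart_act]
    exact Subtype.ext (h x.1)

/-- The converse to `negPartMap`, giving fullness: on positive vectors the extra unit is recovered
as |t|⁻² t (t e₂) from the action of C⁻(L). -/
theorem app_hom_of_negPart (f : P ⟶ P') (h : ω.negPart ⟶ ω'.negPart)
    (hf : (positivePart 𝕜 g).map f = h.1) (y : Y) (x : P.bundle.fiber y) :
    f.1.app y (ω.hom.app y x) = ω'.hom.app y (f.1.app y x) := by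
  have h1 : ∀ x : P.bundle.fiber y, P.actUnit 0 y x = x →
      f.1.app y (ω.hom.app y x) = ω'.hom.app y (f.1.app y x) := by
    intro x hx
    obtain ⟨t, ht⟩ := exists_ne_zero L y
    have hQ := metricForm_cast_ne_zero (g := g) (𝕜 := 𝕜) ht
    have h2 := app_act h t (⟨x, hx⟩ : VecBundle.FixedFiber (involution P) y)
    rw [negPart_act, negPart_act, ← hf] at h2
    have h3 : f.1.app y (-P.actLine t (ω.hom.app y x)) =
      -P'.actLine t (ω'.hom.app y (f.1.app y x)) := congrArg Subtype.val h2
    rw [map_neg, neg_inj, app_actLine] at h3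
    have h4 := congrArg (P'.actLine t) h3
    rw [actLine_actLine_self, actLine_actLine_self] at h4
    exact smul_right_injective _ hQ h4
  have h2 : ∀ x : P.bundle.fiber y, P.actUnit 0 y x = -x →
      f.1.app y (ω.hom.app y x) = ω'.hom.app y (f.1.app y x) := by
    intro x hx
    -- The extra unit exchanges the two parts and is an involution, so the negative case follows
    -- from the positive one.
    have h3 := h1 (ω.hom.app y x) (by rw [ω.actUnit_hom, hx, map_neg, neg_neg])
    rw [ω.hom_hom] at h3
    rw [h3, ω'.hom_hom]
  have h3 : x = (2⁻¹ : 𝕜) • (x + P.actUnit 0 y x) + (2⁻¹ : 𝕜) • (x - P.actUnit 0 y x) := by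
    rw [← smul_add, add_add_sub_cancel, ← two_smul 𝕜 x, smul_smul, inv_mul_cancel₀ two_ne_zero,
      one_smul]
  rw [h3, map_add, map_add, map_add, map_add, h1, h2]
  · rw [map_smul, map_sub, actUnit_actUnit_self, ← smul_neg, neg_sub]
  · rw [map_smul, map_add, actUnit_actUnit_self, add_comm]

end ExtraUnit

end ExtraUnit

/-! ### The second unit vector as an extra unit -/

section Restriction

variable (M : PosCliffordModules.{u, v, w} 𝕜 g 2)

theorem forgetPos_actLine {y : Y} (t : L y) :
    ((forgetPos 𝕜 g 1).obj M).actLine t = M.actLine t := by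
  have h : inclIsometry g 1 y ((t, 0) : addTrivial L 1 y) = ((t, 0) : addTrivial L 2 y) := by
    rw [inclIsometry_apply]
    refine Prod.ext rfl (funext fun i => ?_)
    fin_cases i <;> rfl
  exact (restrict_act (inclIsometry g 1) (continuous_inclIsometry g 1) M _).trans (congrArg M.act h)

/-- The inclusion appends the zero coordinate at the end, so the unit vector of index 0 is kept and
the new one has index 1. -/
theorem forgetPos_actUnit (y : Y) :
    ((forgetPos 𝕜 g 1).obj M).actUnit 0 y = M.actUnit 0 y := by
  have h : inclIsometry g 1 y (unitVec L 0 y) = unitVec L 0 y := by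
    rw [inclIsometry_apply]
    refine Prod.ext rfl (funext fun i => ?_)
    fin_cases i <;> rfl
  exact (restrict_act (inclIsometry g 1) (continuous_inclIsometry g 1) M _).trans (congrArg M.act h)

/-- The additional unit on the restriction of a `C⁺(L + 2)`-module bundle. -/
def extraUnit : ExtraUnit ((forgetPos 𝕜 g 1).obj M) where
  hom := M.actHom (unitVec L 1) (continuous_unitVec L 1)
  hom_hom y x := M.actUnit_actUnit_self 1 y x
  actLine_hom {y} t x := by
    rw [forgetPos_actLine]
    exact M.actLine_actUnit 1 t x
  actUnit_hom y x := by
    rw [forgetPos_actUnit]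
    exact M.actUnit_actUnit (by decide) y x

end Restriction

variable (𝕜 g) in
/-- The functor of positive parts, from `C⁺(L + 2)`-module bundles to `C⁻(L)`-module bundles. -/
def negPart : PosCliffordModules.{u, v, w} 𝕜 g 2 ⥤ NegCliffordModules.{u, v, w} 𝕜 g where
  obj M := (extraUnit M).negPart
  map {M N} f := ExtraUnit.negPartMap (ω := extraUnit M) (ω' := extraUnit N)
    ((forgetPos 𝕜 g 1).map f) fun y x => app_actUnit f 1 y x

instance : (negPart.{u, v, w} 𝕜 g).Additive where
  map_add := rfl

variable (𝕜 g) in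
/-- The functors of positive parts are compatible with the forgetful functors. -/
def negPartForgetIso :
    forgetPos.{u, v, w} 𝕜 g 1 ⋙ positivePart 𝕜 g ≅ negPart 𝕜 g ⋙ forgetNeg 𝕜 g :=
  NatIso.ofComponents (fun M => Iso.refl ((positivePart 𝕜 g).obj ((forgetPos 𝕜 g 1).obj M)))
    fun _ => (Category.comp_id _).trans (Category.id_comp _).symm

theorem isInducing_forgetPos_map {M N : PosCliffordModules.{u, v, w} 𝕜 g 2} :
    Topology.IsInducing (fun f : M ⟶ N => (forgetPos 𝕜 g 1).map f) :=
  (isInducing_val.of_comp_iff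
    (f := fun f : M ⟶ N => (forgetPos 𝕜 g 1).map f)).1 isInducing_val

/-- Topology and injectivity come from `positivePart` after forgetting both actions. For
surjectivity the underlying map is extended as a C⁺(L + 1)-morphism, which commutes with e₂ because
the given map commutes with C⁻(L). -/
instance [LocallyCompactSpace Y] : IsHomHomeomorph (negPart.{u, v, w} 𝕜 g) where
  isHomeomorph M N := by
    have hind := ((IsHomHomeomorph.isHomeomorph (G := positivePart 𝕜 g)
      ((forgetPos 𝕜 g 1).obj M) ((forgetPos 𝕜 g 1).obj N)).isInducing.comp
        (isInducing_forgetPos_map (M := M) (N := N)))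
    rw [isHomeomorph_iff_isEmbedding_surjective]
    refine ⟨⟨(isInducing_val.of_comp_iff
      (f := fun f : M ⟶ N => (negPart 𝕜 g).map f)).1 hind, ?_⟩, ?_⟩
    · intro f f' hff
      have h1 : (positivePart 𝕜 g).map ((forgetPos 𝕜 g 1).map f) =
        (positivePart 𝕜 g).map ((forgetPos 𝕜 g 1).map f') := congrArg Subtype.val hff
      have h2 := (positivePart 𝕜 g).map_injective h1
      exact Subtype.ext (congrArg (fun k : (forgetPos 𝕜 g 1).obj M ⟶ (forgetPos 𝕜 g 1).obj N => k.1)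
        h2)
    · intro h
      obtain ⟨f, hf⟩ := (positivePart 𝕜 g).map_surjective
        (X := (forgetPos 𝕜 g 1).obj M) (Y := (forgetPos 𝕜 g 1).obj N) h.1
      have hU := ExtraUnit.app_hom_of_negPart (ω := extraUnit M) (ω' := extraUnit N) f h hf
      refine ⟨homMkOfUnits (M := M) (N := N) f.1 (fun y t x => ?_) (fun i y x => ?_),
        Subtype.ext hf⟩
      · have h1 := app_actLine f t x
        rw [forgetPos_actLine, forgetPos_actLine] at h1
        exact h1
      · fin_cases i
        · have h1 := app_actUnit f 0 y x
          rw [forgetPos_actUnit, forgetPos_actUnit] at h1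
          exact h1
        · exact hU y x

end CliffordModuleBundle

/-! ### Every `C⁻(L)`-module bundle is a positive part -/

namespace CliffordModuleBundle

set_option linter.unusedSectionVars false

variable {𝕜 : Type} [RCLike 𝕜] {Y : Type u} [TopologicalSpace Y]
  {L : Y → Type w} [∀ y, AddCommGroup (L y)] [∀ y, Module ℝ (L y)]
  [∀ y, TopologicalSpace (L y)]
  [TopologicalSpace (TotalSpace ℝ L)] [FiberBundle ℝ L] [VectorBundle ℝ ℝ L]
  {g : ContinuousRiemannianMetric ℝ L} (N : NegCliffordModules.{u, v, w} 𝕜 g)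

/-- The action of `L + 2` on the double of a `C⁻(L)`-module. -/
def doubleAct {y : Y} (t : addTrivial L 2 y) :
    Module.End 𝕜 (N.bundle.fiber y × N.bundle.fiber y) :=
  LinearMap.prod
    (-(N.act t.1 ∘ₗ LinearMap.snd 𝕜 _ _) + ((t.2 0 : ℝ) : 𝕜) • LinearMap.fst 𝕜 _ _ +
      ((t.2 1 : ℝ) : 𝕜) • LinearMap.snd 𝕜 _ _)
    (N.act t.1 ∘ₗ LinearMap.fst 𝕜 _ _ + (-((t.2 0 : ℝ) : 𝕜)) • LinearMap.snd 𝕜 _ _ +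
      ((t.2 1 : ℝ) : 𝕜) • LinearMap.fst 𝕜 _ _)

theorem doubleAct_apply {y : Y} (t : addTrivial L 2 y) (a b : N.bundle.fiber y) :
    N.doubleAct t (a, b) =
      (-N.act t.1 b + ((t.2 0 : ℝ) : 𝕜) • a + ((t.2 1 : ℝ) : 𝕜) • b,
        N.act t.1 a + (-((t.2 0 : ℝ) : 𝕜)) • b + ((t.2 1 : ℝ) : 𝕜) • a) := rfl

theorem doubleAct_add {y : Y} (s t : addTrivial L 2 y) :
    N.doubleAct (s + t) = N.doubleAct s + N.doubleAct t := by
  refine LinearMap.ext fun ⟨a, b⟩ => ?_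
  rw [LinearMap.add_apply, doubleAct_apply, doubleAct_apply, doubleAct_apply]
  simp only [Prod.fst_add, Prod.snd_add, Pi.add_apply, act_add, LinearMap.add_apply,
    Prod.mk_add_mk, RCLike.ofReal_add]
  refine Prod.ext ?_ ?_ <;> dsimp only <;> module

theorem doubleAct_smul {y : Y} (c : ℝ) (t : addTrivial L 2 y) :
    N.doubleAct (c • t) = (c : 𝕜) • N.doubleAct t := by
  refine LinearMap.ext fun ⟨a, b⟩ => ?_
  rw [LinearMap.smul_apply, doubleAct_apply, doubleAct_apply]
  simp only [Prod.smul_fst, Prod.smul_snd, Pi.smul_apply, act_smul, Prod.smul_mk, smul_eq_mul,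
    RCLike.ofReal_mul]
  refine Prod.ext ?_ ?_ <;> dsimp only <;> module

/-- The matrix has rows (x₁, x₂ - t) and (x₂ + t, -x₁), where t squares to -|t|² on N. The
off-diagonal entries of its square cancel, and each diagonal entry is x₁² + x₂² - t² = x₁² + x₂² +
|t|². -/
theorem doubleAct_doubleAct {y : Y} (t : addTrivial L 2 y)
    (p : N.bundle.fiber y × N.bundle.fiber y) :
    N.doubleAct t (N.doubleAct t p) = ((posForm g 2 y t : ℝ) : 𝕜) • p := by
  obtain ⟨a, b⟩ := p
  rw [doubleAct_apply, doubleAct_apply, posForm_apply]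
  simp only [map_add, map_neg, map_smul, act_act_self, negForm_apply, Fin.sum_univ_two,
    RCLike.ofReal_mul, Prod.smul_mk]
  refine Prod.ext ?_ ?_ <;> dsimp only <;> module

/-- The double of a `C⁻(L)`-module bundle, as a `C⁺(L + 2)`-module bundle. -/
def double : PosCliffordModules.{u, v, w} 𝕜 g 2 :=
  ofGenerators (N.bundle.prod N.bundle) (fun _ t => N.doubleAct t)
    (fun _ s t => N.doubleAct_add s t) (fun _ c t => N.doubleAct_smul c t)
    (fun _ t p => N.doubleAct_doubleAct t p)
    (by
      have hind := FiberBundle.Prod.isInducing_diag (ℝ × (Fin 2 → ℝ)) (addTrivial L 2) PUnit.{1}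
        (N.bundle.prod N.bundle).fiber
      have hT := continuous_fst.comp hind.continuous
      have hx := continuous_snd.comp hind.continuous
      have ht := (continuous_addTrivial_fst (F := ℝ) (L := L) 2).comp hT
      have hc := (continuous_addTrivial_snd (F := ℝ) (L := L) 2).comp hT
      have hc0 := (RCLike.continuous_ofReal (K := 𝕜)).comp ((continuous_apply 0).comp hc)
      have hc1 := (RCLike.continuous_ofReal (K := 𝕜)).comp ((continuous_apply 1).comp hc)
      have ha := (VecBundle.continuous_prod_fst N.bundle N.bundle).comp hx
      have hb := (VecBundle.continuous_prod_snd N.bundle N.bundle).comp hx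
      refine (VecBundle.continuous_prod_iff N.bundle N.bundle).2 ⟨?_, ?_⟩
      · exact VecBundle.continuous_add (VecBundle.continuous_add
          (VecBundle.continuous_neg (N.continuous_act ht hb)) (VecBundle.continuous_smul hc0 ha))
          (VecBundle.continuous_smul hc1 hb)
      · exact VecBundle.continuous_add (VecBundle.continuous_add
          (N.continuous_act ht ha) (VecBundle.continuous_smul hc0.neg hb))
          (VecBundle.continuous_smul hc1 ha))

theorem double_act {y : Y} (t : addTrivial L 2 y) : N.double.act t = N.doubleAct t :=
  ofGenerators_act _ _ _ _ _ _ t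

theorem double_actLine {y : Y} (t : L y) (a b : N.bundle.fiber y) :
    N.double.actLine t (a, b) = (-N.act t b, N.act t a) := by
  refine (DFunLike.congr_fun (N.double_act _) (a, b)).trans ((doubleAct_apply _ _ _ _).trans ?_)
  simp

theorem double_actUnit_zero (y : Y) (a b : N.bundle.fiber y) :
    N.double.actUnit 0 y (a, b) = (a, -b) := by
  refine (DFunLike.congr_fun (N.double_act _) (a, b)).trans ((doubleAct_apply _ _ _ _).trans ?_)
  simp [unitVec, act]

theorem double_actUnit_one (y : Y) (a b : N.bundle.fiber y) :
    N.double.actUnit 1 y (a, b) = (b, a) := by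
  refine (DFunLike.congr_fun (N.double_act _) (a, b)).trans ((doubleAct_apply _ _ _ _).trans ?_)
  simp [unitVec, act]

theorem involution_double (y : Y) (a b : N.bundle.fiber y) :
    (involution ((forgetPos 𝕜 g 1).obj N.double)).app y (a, b) = (a, -b) :=
  (DFunLike.congr_fun (N.double.forgetPos_actUnit y) (a, b)).trans (N.double_actUnit_zero y a b)

theorem snd_eq_zero_of_fixed {y : Y}
    (x : VecBundle.FixedFiber (involution ((forgetPos 𝕜 g 1).obj N.double)) y) :
    (x.1 : N.bundle.fiber y × N.bundle.fiber y).2 = 0 := by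
  obtain ⟨⟨a, b⟩, hx⟩ := x
  have h1 : ((a, -b) : N.bundle.fiber y × N.bundle.fiber y) = (a, b) :=
    (N.involution_double y a b).symm.trans hx
  have h2 : -b = b := congrArg Prod.snd h1
  rw [neg_eq_iff_add_eq_zero, ← two_smul 𝕜] at h2
  exact (smul_eq_zero.1 h2).resolve_left two_ne_zero

/-- Positive vectors are the pairs (a, 0). There e₂ gives (0, a), then t gives (-ta, 0), and the
sign in `rotate` restores the original action. -/
theorem rotate_double {y : Y} (t : L y)
    (x : VecBundle.FixedFiber (involution ((forgetPos 𝕜 g 1).obj N.double)) y) :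
    (((extraUnit N.double).rotate t x).1 : N.bundle.fiber y × N.bundle.fiber y) =
      (N.act t (x.1 : N.bundle.fiber y × N.bundle.fiber y).1, 0) := by
  have h2 := N.snd_eq_zero_of_fixed x
  obtain ⟨⟨a, b⟩, hx⟩ := x
  obtain rfl : b = 0 := h2
  have h3 : ((forgetPos 𝕜 g 1).obj N.double).actLine t (N.double.actUnit 1 y (a, 0)) =
      (-N.act t a, 0) :=
    (DFunLike.congr_fun (N.double.forgetPos_actLine t) _).trans
      ((congrArg (N.double.actLine t) (N.double_actUnit_one y a 0)).trans
        ((N.double_actLine t 0 a).trans (Prod.ext rfl (map_zero _))))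
  refine (congrArg Neg.neg h3).trans ?_
  exact Prod.ext (neg_neg _) neg_zero

/-- The inclusion of a `C⁻(L)`-module in the positive part of its double. -/
def doubleIncl (y : Y) : N.bundle.fiber y →ₗ[𝕜]
    VecBundle.FixedFiber (involution ((forgetPos 𝕜 g 1).obj N.double)) y :=
  LinearMap.codRestrict _ (LinearMap.inl 𝕜 (N.bundle.fiber y) (N.bundle.fiber y)) fun x =>
    (N.involution_double y x 0).trans (Prod.ext rfl neg_zero)

/-- A `C⁻(L)`-module bundle is isomorphic to the positive part of its double. -/
def negPartDoubleIso : (negPart 𝕜 g).obj N.double ≅ N where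
  hom := homMk
    { app := fun y => LinearMap.fst 𝕜 (N.bundle.fiber y) (N.bundle.fiber y) ∘ₗ
        Submodule.subtype _
      continuous_totalMap := (VecBundle.continuous_prod_fst N.bundle N.bundle).comp
        (VecBundle.continuous_fixed_incl (involution ((forgetPos 𝕜 g 1).obj N.double))) }
    fun y t x => (congrArg (fun k : Module.End 𝕜 (VecBundle.FixedFiber
      (involution ((forgetPos 𝕜 g 1).obj N.double)) y) =>
        ((k x).1 : N.bundle.fiber y × N.bundle.fiber y).1)
      ((extraUnit N.double).negPart_act t)).trans (congrArg Prod.fst (N.rotate_double t x))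
  inv := homMk
    { app := N.doubleIncl
      continuous_totalMap := (VecBundle.continuous_fixed_iff (involution_involution _)
        (b := fun z : N.bundle.Total => z.proj)).2
          ((VecBundle.continuous_prod_iff N.bundle N.bundle).2
            ⟨continuous_id, (0 : N.bundle ⟶ N.bundle).continuous_totalMap⟩) }
    fun y t x => Subtype.ext ((N.rotate_double t (N.doubleIncl y x)).symm.trans
      (congrArg (fun k : Module.End 𝕜 (VecBundle.FixedFiber
        (involution ((forgetPos 𝕜 g 1).obj N.double)) y) => (k (N.doubleIncl y x)).1)
        ((extraUnit N.double).negPart_act t).symm))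
  hom_inv_id := Subtype.ext (VecBundle.hom_ext fun _ => LinearMap.ext fun x =>
    Subtype.ext (Prod.ext rfl (N.snd_eq_zero_of_fixed x).symm))
  inv_hom_id := rfl

instance : (negPart.{u, v, w} 𝕜 g).EssSurj where
  mem_essImage N := ⟨N.double, ⟨N.negPartDoubleIso⟩⟩

end CliffordModuleBundle

end

theorem lemma4p2 {𝕜 : Type} [RCLike 𝕜]
    {Y : Type u} [TopologicalSpace Y] [CompactSpace Y] [T2Space Y]
    (L : Y → Type v) [∀ y, AddCommGroup (L y)] [∀ y, Module ℝ (L y)]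
    [∀ y, TopologicalSpace (L y)] [TopologicalSpace (TotalSpace ℝ L)]
    [FiberBundle ℝ L] [VectorBundle ℝ ℝ L] (g : ContinuousRiemannianMetric ℝ L) (i : ℤ) :
    Nonempty (KGroup (forgetNeg.{u, v, v} 𝕜 g) i ≃+ KGroup (forgetPos.{u, v, v} 𝕜 g 1) i) := by
  -- The functors go from the Clifford modules of L + 2 and L + 1 to the other side, hence the
  -- inverse. The index n depends on i alone, so it is the same for both groups.
  exact ⟨(KGroupNat.equivOfSquare (C := PosCliffordModules.{u, v, v} 𝕜 g 2)
    (φ := forgetPos.{u, v, v} 𝕜 g 1) (φ' := forgetNeg.{u, v, v} 𝕜 g)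
    (G := CliffordModuleBundle.negPart.{u, v, v} 𝕜 g)
    (G₀ := CliffordModuleBundle.positivePart.{u, v, v} 𝕜 g)
    (CliffordModuleBundle.negPartForgetIso.{u, v, v} 𝕜 g) _).symm⟩
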